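/- An instance $\mathcal I=(I,w,v,m,k)$ of CMK consists of a finite set of items $I$, weights $w:I\to[0,1]$, values $v:I\to\mathbb R_{\ge 0}$, a number of bins $m\in\mathbb N_{>0}$ and a cardinality bound $k\in\mathbb N_{>0}$. A configuration is a set $C\subseteq I$ with $|C|\le k$ and $\sum_{i\in C}w(i)\le 1$; let $\mathcal C$ be the set of configurations. For $B\subseteq I$ put $v(B)=\sum_{i\in B}v(i)$, and let $\mathrm{OPT}(\mathcal I)$ be the maximum of $v(C_1\cup\dots\cup C_m)$ over $(C_1,\dots,C_m)\in\mathcal C^m$. For $x\in\mathbb R_{\ge 0}^{\mathcal C}$ let $\mathrm{cover}_i(x)=\sum_{C\in\mathcal C,\,i\in C}x_C$, $\|x\|=\sum_{C\in\mathcal C}x_C$ and $v(x)=\sum_{i\in I}v(i)\,\mathrm{cover}_i(x)$. For $S\subseteq I$ and $\ell\in\mathbb N$, $\mathrm{LP}(S,\ell)$ asks to maximize $v(x)$ over all $x\in\mathbb R_{\ge 0}^{\mathcal C}$ with $\mathrm{cover}_i(x)\le 1$ for all $i\in I$, with $x_C=0$ unless $C\subseteq S$, and with $\|x\|=\ell$;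 a $(1-\varepsilon)$-approximate solution is a feasible $x$ whose value is at least $(1-\varepsilon)$ times the maximum. Let $\varepsilon\in(0,0.1)$ with $\varepsilon^{-1/2}\in\mathbb N$, and let $\mathcal I$ be an $\varepsilon$-simple CMK instance, that is, $m>\exp(\exp(\varepsilon^{-30}))$ and $\varepsilon m\in\mathbb N$. Iterative randomized rounding starts with $S_0=I$ and, for $j=1,\dots,\varepsilon^{-1}$, takes a $(1-\varepsilon)$-approximate solution $x^j$ of $\mathrm{LP}(S_{j-1},m(1-(j-1)\varepsilon))$, which may be chosen arbitrarily as a function of the configurations sampled in iterations $1,\dots,j-1$; samples $q=\varepsilon m$ configurations $R^j_1,\dots,R^j_q$ that, given the previous iterations, are independent with $\Pr(R^j_b=C)=x^j_C/\|x^j\|$ for all $C\in\mathcal C$; and sets $S_j=S_{j-1}\setminus\bigcup_{b=1}^{q}R^j_b$. Let $V=v\bigl(\bigcup_{j=1}^{\varepsilon^{-1}}\bigcup_{b=1}^{q}R^j_b\bigr)$ be the value of the returned solution. Then, for every such choice of the solutions $x^j$, $$\mathbb E[V]\;\ge\;\bigl(1-300\,\varepsilon^{1/2}\bigr)\cdot\mathrm{OPT}(\mathcal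 I).$$ -/

import Mathlib

open scoped NNReal ENNReal

/-- An instance `(I, w, v, m, k)` of Uniform Cardinality Constrained Multiple Knapsack (CMK)
whose set of items is the finite type `I`. -/
structure CMK (I : Type*) where
  /-- the weight function -/
  w : I → ℝ
  /-- the value function -/
  v : I → ℝ
  /-- the number of bins -/
  m : ℕ
  /-- the cardinality constraint -/
  k : ℕ
  w_nonneg : ∀ i, 0 ≤ w i
  w_le_one : ∀ i, w i ≤ 1
  v_nonneg : ∀ i, 0 ≤ v i
  m_pos : 0 < m
  k_pos : 0 < k

namespace CMK

variable {I : Type*} [Fintype I] [DecidableEq I]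

/-- A configuration: a set of at most `k` items of total weight at most `1`. -/
def IsConfig (P : CMK I) (C : Finset I) : Prop :=
  C.card ≤ P.k ∧ ∑ i ∈ C, P.w i ≤ 1

/-- The set of all configurations of the instance. -/
abbrev Config (P : CMK I) : Type _ := {C : Finset I // P.IsConfig C}

noncomputable instance instFintypeConfig (P : CMK I) : Fintype P.Config :=
  Fintype.ofFinite _

/-- The empty configuration. -/
def emptyConfig (P : CMK I) : P.Config := ⟨∅, by simp [IsConfig]⟩

instance instNonemptyConfig (P : CMK I) : Nonempty P.Config := ⟨P.emptyConfig⟩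

/-- The value `v(B)` of a set `B` of items. -/
def setValue (P : CMK I) (B : Finset I) : ℝ := ∑ i ∈ B, P.v i

/-- The value of a solution `(C_1, …, C_m)`: every item of the union is counted once. -/
def solutionValue (P : CMK I) (C : Fin P.m → P.Config) : ℝ :=
  P.setValue (Finset.univ.biUnion fun b => (C b).1)

/-- `OPT`, the largest value of a solution (there are finitely many solutions). -/
noncomputable def opt (P : CMK I) : ℝ := ⨆ C : Fin P.m → P.Config, P.solutionValue C

theorem opt_isGreatest (P : CMK I) : IsGreatest (Set.range P.solutionValue) P.opt := by
  obtain ⟨C, hC⟩ := Finite.exists_max P.solutionValue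
  have h : P.opt = P.solutionValue C :=
    le_antisymm (ciSup_le hC) (le_ciSup (Set.finite_range P.solutionValue).bddAbove C)
  rw [h]
  exact ⟨⟨C, rfl⟩, by rintro _ ⟨D, rfl⟩; exact hC D⟩

/-- `ε`-simple instances. -/
def IsSimple (P : CMK I) (ε : ℝ) : Prop :=
  Real.exp (Real.exp (ε ^ (-30 : ℤ))) < (P.m : ℝ) ∧ ∃ q : ℕ, ε * P.m = q

/-- Fractional solutions: non-negative vectors indexed by the configurations. -/
abbrev FracSol (P : CMK I) : Type _ := P.Config → ℝ≥0

/-- The coverage of the item `i` by a fractional solution. -/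
noncomputable def cover (P : CMK I) (x : P.FracSol) (i : I) : ℝ :=
  ∑ C with i ∈ C.1, (x C : ℝ)

/-- The size `‖x‖` of a fractional solution. -/
noncomputable def size (P : CMK I) (x : P.FracSol) : ℝ := ∑ C, (x C : ℝ)

/-- The value of a fractional solution, that is, the value of its coverage. -/
noncomputable def fracValue (P : CMK I) (x : P.FracSol) : ℝ := ∑ i, P.cover x i * P.v i

/-- `x` satisfies the constraints of the configuration LP with remaining items `S` and `l` bins. -/
def LPFeasible (P : CMK I) (S : Finset I) (l : ℝ) (x : P.FracSol) : Prop :=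
  (∀ i, P.cover x i ≤ 1) ∧ (∀ C, x C ≠ 0 → C.1 ⊆ S) ∧ P.size x = l

/-- `x` is a `(1 - ε)`-approximate solution of the configuration LP: it is feasible and its value
is at least `1 - ε` times the value of every feasible solution, hence of an optimal one. -/
def LPApprox (P : CMK I) (ε : ℝ) (S : Finset I) (l : ℝ) (x : P.FracSol) : Prop :=
  P.LPFeasible S l x ∧ ∀ z, P.LPFeasible S l z → (1 - ε) * P.fracValue z ≤ P.fracValue x

/-- The distribution of a random configuration `R ∼ x`, i.e. `Pr (R = C) = x C / ‖x‖`.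
It is only meaningful for `x ≠ 0`; for `x = 0` the value is a placeholder. -/
noncomputable def configLaw (P : CMK I) (x : P.FracSol) : PMF P.Config :=
  open Classical in
  if hx : ∑' C, (x C : ℝ≥0∞) = 0 then PMF.pure P.emptyConfig
  else PMF.normalize (fun C => (x C : ℝ≥0∞)) hx
    (by rw [tsum_fintype]; exact (ENNReal.sum_lt_top.2 fun _ _ => ENNReal.coe_lt_top).ne)

/-- The joint distribution of `q` independent samples from `p`. -/
noncomputable def iidLaw {α : Type*} [Fintype α] (p : PMF α) (q : ℕ) : PMF (Fin q → α) :=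
  PMF.ofFintype (fun r => ∏ b, p (r b)) (by
    classical
    have h : ∏ _b : Fin q, ∑ a, p a = ∑ r : Fin q → α, ∏ b, p (r b) := by
      rw [Finset.prod_univ_sum, Fintype.piFinset_univ]
    rw [← h, ← tsum_fintype (L := .unconditional _), p.tsum_coe]
    simp)

/-- The samples of the first `j` iterations, with `q` configurations sampled in each:
`h a b` is the `b`-th configuration sampled in the `a`-th iteration (counted from `0`). -/
abbrev History (P : CMK I) (q j : ℕ) : Type _ := Fin j → Fin q → P.Config

/-- The items packed in the first `j` iterations. -/
def packed (P : CMK I) {q j : ℕ} (h : P.History q j) : Finset I :=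
  Finset.univ.biUnion fun a => Finset.univ.biUnion fun b => (h a b).1

/-- The items `S_j` that remain after the first `j` iterations. -/
def remaining (P : CMK I) {q j : ℕ} (h : P.History q j) : Finset I :=
  Finset.univ \ P.packed h

/-- A rule for choosing the LP solution of the next iteration. The choice may depend on all the
configurations sampled so far. -/
abbrev LPRule (P : CMK I) (q : ℕ) : Type _ := (j : ℕ) → P.History q j → P.FracSol

/-- In each of the `N` iterations, after `j < N` completed ones, the rule returns a
`(1 - ε)`-approximate solution of the configuration LP with the remaining items and
the `m * (1 - j * ε)` remaining bins. -/
def LPRule.IsApprox {P : CMK I} {q : ℕ} (X : P.LPRule q) (ε : ℝ) (N : ℕ) : Prop :=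
  ∀ j < N, ∀ h : P.History q j, P.LPApprox ε (P.remaining h) (P.m * (1 - j * ε)) (X j h)

/-- Iterative randomized rounding: the distribution of the samples of the first `j` iterations.
In each iteration `q` configurations are sampled, independently given the past, from the
distribution given by the LP solution that the rule `X` chooses. -/
noncomputable def run (P : CMK I) {q : ℕ} (X : P.LPRule q) : (j : ℕ) → PMF (P.History q j)
  | 0 => PMF.pure Fin.elim0
  | j + 1 => (P.run X j).bind fun h =>
      (iidLaw (P.configLaw (X j h)) q).map fun r => Fin.snoc (α := fun _ => Fin q → P.Config) h r

/-- The number `ε⁻¹` of iterations (the floor is exact whenever `ε⁻¹` is an integer). -/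
noncomputable def numIter (ε : ℝ) : ℕ := ⌊ε⁻¹⌋₊

/-- The number `ε * m` of samples per iteration (the floor is exact for `ε`-simple instances). -/
noncomputable def batch (P : CMK I) (ε : ℝ) : ℕ := ⌊ε * P.m⌋₊

/-- The expected value `E[V]` of the solution returned by iterative randomized rounding with
parameter `ε`, when the LP solutions are chosen by the rule `X`. -/
noncomputable def expectedValue (P : CMK I) (ε : ℝ) (X : P.LPRule (P.batch ε)) : ℝ :=
  ∑ h : P.History (P.batch ε) (numIter ε),
    (P.run X (numIter ε) h).toReal * P.setValue (P.packed h)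

end CMK

/-! Write `s = ε ^ (-1/2)`, `q = ε m`, `m = q s²`, and `p = 1 - jε` for the fraction of bins left
after `j` iterations. If the linear program then still has expected value about `p · OPT`, the next
batch of `q` samples, drawn from a solution of size `pm`, collects about `(ε / p) · p · OPT = ε ·
OPT`. The `1 / ε` iterations together collect about `OPT`. With `r = s² - j` iterations to go, the
relative loss in a step is of order `1 / r + 1 / s²`. The last `s` or so iterations are therefore
given up, and the others lose at most `11 / s` each (`le_expect_setValue_packed`).

The core is the lower bound on the linear program (`le_expect_fracValue`). Fix an optimal solution
with item set `O`. Its unpacked items do not survive uniformly, because an LP solution may cover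
some items less than others. An item survives an iteration with conditional probability at least `1
- q / ‖x‖`, so survivors can be down-weighted to make every expected weight exactly `p`. Rounding
these weights by independent coins gives a random set `T` of unpacked items that contains each item
with probability exactly `p` (`exists_survivor_law`). Two items are missed together at most slightly
more often than independent ones, and the excess is governed by how often they share a
configuration. Hence a linear functional bounded by `τ` on configurations has second moment at most
`2mτ²` around its target value on `T`.

It remains to see that `T ∩ O` fits into `pm + 8q` bins whenever a bounded number of such
functionals do not exceed their targets by much (`exists_test_functionals`,
`exists_packs_of_sampled`). This is linear grouping. The large items of `O` are sorted into groups
of `q` items, and bins are classified by how many items of each group they hold. Sampled items of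
one group take the slots of the next heavier group in about `p` times as many bins of every class.
Small items fill the remaining room by sorted round robin. The exceptions fit into `8q` bins. With
at most `B` classes and at most `B³` functionals, Chebyshev's inequality bounds the total failure by
`2B⁹ / m`, which is at most `ε` since `B¹⁰ ≤ q`. Scaling the packing by `p / (p + 8ε)` yields a
feasible LP solution. The doubly exponential lower bound on `m` serves only to ensure `B¹⁰ ≤ q`. -/

set_option linter.unusedSectionVars false

/-! ### Expectations over finite types -/

namespace PMF

variable {α β : Type*} [Fintype α] [Fintype β]

/-- The expectation of a real function on a finite type. -/
noncomputable def expect (p : PMF α) (f : α → ℝ) : ℝ := ∑ a, (p a).toReal * f a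

theorem sum_toReal (p : PMF α) : ∑ a, (p a).toReal = 1 := by
  rw [← ENNReal.toReal_sum fun a _ => p.apply_ne_top a, ← tsum_fintype (L := .unconditional _),
    p.tsum_coe, ENNReal.toReal_one]

theorem expect_const (p : PMF α) (c : ℝ) : p.expect (fun _ => c) = c := by
  rw [expect, ← Finset.sum_mul, sum_toReal, one_mul]

theorem expect_add (p : PMF α) (f g : α → ℝ) :
    p.expect (fun a => f a + g a) = p.expect f + p.expect g := by
  simp only [expect, mul_add, Finset.sum_add_distrib]

theorem expect_sub (p : PMF α) (f g : α → ℝ) :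
    p.expect (fun a => f a - g a) = p.expect f - p.expect g := by
  simp only [expect, mul_sub, Finset.sum_sub_distrib]

theorem expect_const_mul (p : PMF α) (c : ℝ) (f : α → ℝ) :
    p.expect (fun a => c * f a) = c * p.expect f := by
  simp only [expect, Finset.mul_sum]
  exact Finset.sum_congr rfl fun a _ => by ring

theorem expect_mul_const (p : PMF α) (c : ℝ) (f : α → ℝ) :
    p.expect (fun a => f a * c) = p.expect f * c := by
  simp only [expect, Finset.sum_mul]
  exact Finset.sum_congr rfl fun a _ => by ring

theorem expect_sum {ι : Type*} (p : PMF α) (S : Finset ι) (f : ι → α → ℝ) :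
    p.expect (fun a => ∑ i ∈ S, f i a) = ∑ i ∈ S, p.expect (f i) := by
  simp only [expect, Finset.mul_sum]
  exact Finset.sum_comm

theorem expect_mono (p : PMF α) {f g : α → ℝ} (h : ∀ a, f a ≤ g a) : p.expect f ≤ p.expect g :=
  Finset.sum_le_sum fun a _ => mul_le_mul_of_nonneg_left (h a) ENNReal.toReal_nonneg

theorem expect_nonneg (p : PMF α) {f : α → ℝ} (h : ∀ a, 0 ≤ f a) : 0 ≤ p.expect f :=
  Finset.sum_nonneg fun a _ => mul_nonneg ENNReal.toReal_nonneg (h a)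

theorem expect_pure (a : α) (f : α → ℝ) : (PMF.pure a).expect f = f a := by
  classical
  rw [expect, Finset.sum_eq_single a]
  · simp
  · intro b _ hb
    simp [PMF.pure_apply, hb]
  · simp

theorem expect_bind (p : PMF α) (g : α → PMF β) (f : β → ℝ) :
    (p.bind g).expect f = p.expect fun a => (g a).expect f := by
  simp only [expect, PMF.bind_apply, tsum_fintype, Finset.mul_sum]
  rw [Finset.sum_comm]
  refine Finset.sum_congr rfl fun b _ => ?_
  rw [ENNReal.toReal_sum fun a _ => ENNReal.mul_ne_top (p.apply_ne_top a) ((g a).apply_ne_top b),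
    Finset.sum_mul]
  exact Finset.sum_congr rfl fun a _ => by rw [ENNReal.toReal_mul, mul_assoc]

theorem expect_map (p : PMF α) (g : α → β) (f : β → ℝ) :
    (p.map g).expect f = p.expect fun a => f (g a) := by
  rw [← PMF.bind_pure_comp, expect_bind]
  simp only [Function.comp_apply, expect_pure]

end PMF

/-! ### Sampling one batch of configurations. -/

namespace CMK

theorem expect_iidLaw_prod {α : Type*} [Fintype α] (p : PMF α) (q : ℕ) (g : α → ℝ) :
    (iidLaw p q).expect (fun r => ∏ b, g (r b)) = p.expect g ^ q := by
  classical
  have h : ∏ _b : Fin q, ∑ a, (p a).toReal * g a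
      = ∑ r : Fin q → α, ∏ b, ((p (r b)).toReal * g (r b)) := by
    rw [Finset.prod_univ_sum, Fintype.piFinset_univ]
  rw [Finset.prod_const, Finset.card_univ, Fintype.card_fin] at h
  rw [PMF.expect, PMF.expect, h]
  refine Finset.sum_congr rfl fun r _ => ?_
  rw [iidLaw, PMF.ofFintype_apply, ENNReal.toReal_prod, Finset.prod_mul_distrib]

variable {I : Type*} [Fintype I] [DecidableEq I] {P : CMK I}

theorem configLaw_toReal {x : P.FracSol} (hx : 0 < P.size x) (C : P.Config) :
    (P.configLaw x C).toReal = x C / P.size x := by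
  have hsum : ∑' C, (x C : ℝ≥0∞) = ENNReal.ofReal (P.size x) := by
    rw [tsum_fintype, size, ENNReal.ofReal_sum_of_nonneg fun _ _ => NNReal.coe_nonneg _]
    simp
  have h0 : ¬ ∑' C, (x C : ℝ≥0∞) = 0 := by
    rw [hsum, ENNReal.ofReal_eq_zero, not_le]
    exact hx
  rw [configLaw, dif_neg h0, PMF.normalize_apply, ENNReal.toReal_mul, ENNReal.toReal_inv, hsum,
    ENNReal.toReal_ofReal hx.le, ENNReal.coe_toReal, div_eq_mul_inv]

theorem expect_configLaw {x : P.FracSol} (hx : 0 < P.size x) (f : P.Config → ℝ) :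
    (P.configLaw x).expect f = (∑ C, x C * f C) / P.size x := by
  rw [PMF.expect, Finset.sum_div]
  exact Finset.sum_congr rfl fun C _ => by rw [configLaw_toReal hx]; ring

/-- The items of the configurations sampled in one iteration. -/
def hit {q : ℕ} (r : Fin q → P.Config) : Finset I := Finset.univ.biUnion fun b => (r b).1

/-- The indicator of the event that the item `i` is not sampled. -/
def missed {q : ℕ} (r : Fin q → P.Config) (i : I) : ℝ := if i ∈ hit r then 0 else 1

theorem missed_eq_prod {q : ℕ} (r : Fin q → P.Config) (i : I) :
    missed r i = ∏ b, if i ∈ (r b).1 then (0 : ℝ) else 1 := by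
  unfold missed hit
  split_ifs with h
  · obtain ⟨b, -, hb⟩ := Finset.mem_biUnion.1 h
    symm
    exact Finset.prod_eq_zero (Finset.mem_univ b) (if_pos hb)
  · refine (Finset.prod_eq_one fun b _ => if_neg fun hb => h ?_).symm
    exact Finset.mem_biUnion.2 ⟨b, Finset.mem_univ _, hb⟩

theorem cover_eq_sum (x : P.FracSol) (i : I) :
    P.cover x i = ∑ C, (x C : ℝ) * if i ∈ C.1 then 1 else 0 := by
  rw [cover, Finset.sum_filter]
  exact Finset.sum_congr rfl fun C _ => by split_ifs <;> simp

theorem cover_nonneg (x : P.FracSol) (i : I) : 0 ≤ P.cover x i :=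
  Finset.sum_nonneg fun _ _ => NNReal.coe_nonneg _

/-- The total amount of configurations containing two given items. -/
noncomputable def pairCover (x : P.FracSol) (i j : I) : ℝ :=
  ∑ C, (x C : ℝ) * ((if i ∈ C.1 then 1 else 0) * if j ∈ C.1 then 1 else 0)

theorem expect_missed {x : P.FracSol} (hx : 0 < P.size x) (q : ℕ) (i : I) :
    (iidLaw (P.configLaw x) q).expect (fun r => missed r i) = (1 - P.cover x i / P.size x) ^ q := by
  simp only [missed_eq_prod]
  rw [expect_iidLaw_prod _ _ fun C : P.Config => if i ∈ C.1 then (0 : ℝ) else 1,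
    expect_configLaw hx]
  congr 1
  rw [eq_sub_iff_add_eq, ← add_div, div_eq_one_iff_eq hx.ne', cover_eq_sum, size,
    ← Finset.sum_add_distrib]
  exact Finset.sum_congr rfl fun C _ => by split_ifs <;> simp

/-- Inclusion–exclusion for a single sample, raised to the power `q` by independence. -/
theorem expect_missed_mul {x : P.FracSol} (hx : 0 < P.size x) (q : ℕ) (i j : I) :
    (iidLaw (P.configLaw x) q).expect (fun r => missed r i * missed r j)
      = (1 - P.cover x i / P.size x - P.cover x j / P.size x + pairCover x i j / P.size x) ^ q := by
  simp only [missed_eq_prod, ← Finset.prod_mul_distrib]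
  rw [expect_iidLaw_prod _ _ fun C : P.Config =>
    (if i ∈ C.1 then (0 : ℝ) else 1) * if j ∈ C.1 then (0 : ℝ) else 1, expect_configLaw hx]
  congr 1
  rw [div_eq_iff hx.ne', add_mul, sub_mul, sub_mul, div_mul_cancel₀ _ hx.ne',
    div_mul_cancel₀ _ hx.ne', div_mul_cancel₀ _ hx.ne', one_mul]
  rw [cover_eq_sum, cover_eq_sum, pairCover, size,
    ← Finset.sum_sub_distrib, ← Finset.sum_sub_distrib, ← Finset.sum_add_distrib]
  exact Finset.sum_congr rfl fun C _ => by split_ifs <;> ring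

/-- Telescoping: replacing one factor `a` by `b` costs at most `d`, since the other factors lie in
`[0, 1]`. -/
theorem pow_sub_pow_le {a b : ℝ} (ha0 : 0 ≤ a) (ha1 : a ≤ 1) (hb0 : 0 ≤ b) (hb1 : b ≤ 1) {d : ℝ}
    (hd : 0 ≤ d) (hab : a - b ≤ d) (q : ℕ) : a ^ q - b ^ q ≤ q * d := by
  induction q with
  | zero => simp
  | succ n ih =>
    have h1 : (a ^ n - b ^ n) * a ≤ n * d := by
      calc (a ^ n - b ^ n) * a ≤ (n * d) * a := mul_le_mul_of_nonneg_right ih ha0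
        _ ≤ n * d := mul_le_of_le_one_right (by positivity) ha1
    have h2 : b ^ n * (a - b) ≤ d := by
      calc b ^ n * (a - b) ≤ b ^ n * d := mul_le_mul_of_nonneg_left hab (by positivity)
        _ ≤ d := mul_le_of_le_one_left hd (pow_le_one₀ hb0 hb1)
    push_cast
    have : a ^ (n + 1) - b ^ (n + 1) = (a ^ n - b ^ n) * a + b ^ n * (a - b) := by ring
    linarith

theorem pairCover_nonneg (x : P.FracSol) (i j : I) : 0 ≤ pairCover x i j :=
  Finset.sum_nonneg fun C _ => by split_ifs <;> simp

/-- Two items are missed together hardly more often than independent items would be. -/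
theorem expect_missed_mul_le {x : P.FracSol} (hx : 0 < P.size x) (q : ℕ) (i j : I)
    (hi : P.cover x i ≤ P.size x) (hj : P.cover x j ≤ P.size x) :
    (iidLaw (P.configLaw x) q).expect (fun r => missed r i * missed r j)
      ≤ (1 - P.cover x i / P.size x) ^ q * (1 - P.cover x j / P.size x) ^ q
        + q * (pairCover x i j / P.size x) := by
  rw [expect_missed_mul hx, ← mul_pow, ← sub_le_iff_le_add']
  have hpij : pairCover x i j ≤ P.cover x i := by
    rw [cover_eq_sum]
    refine Finset.sum_le_sum fun C _ => mul_le_mul_of_nonneg_left ?_ (NNReal.coe_nonneg _)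
    split_ifs <;> simp
  have hsum : P.cover x i + P.cover x j - pairCover x i j ≤ P.size x := by
    rw [cover_eq_sum, cover_eq_sum, pairCover, size, ← Finset.sum_add_distrib,
      ← Finset.sum_sub_distrib]
    refine Finset.sum_le_sum fun C _ => ?_
    have := (x C).coe_nonneg
    split_ifs <;> simp [this]
  have e0 : 0 ≤ P.cover x i / P.size x := div_nonneg (cover_nonneg _ _) hx.le
  have e1 : 0 ≤ P.cover x j / P.size x := div_nonneg (cover_nonneg _ _) hx.le
  have e2 : P.cover x i / P.size x ≤ 1 := (div_le_one hx).2 hi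
  have e3 : P.cover x j / P.size x ≤ 1 := (div_le_one hx).2 hj
  have e4 : 0 ≤ pairCover x i j / P.size x := div_nonneg (pairCover_nonneg _ _ _) hx.le
  have e5 : pairCover x i j / P.size x ≤ P.cover x i / P.size x := by gcongr
  have e6 : P.cover x i / P.size x + P.cover x j / P.size x - pairCover x i j / P.size x ≤ 1 := by
    rw [← add_div, ← sub_div]
    exact (div_le_one hx).2 hsum
  -- With `a`, `b` the two normalized covers, the product of the single probabilities is `1 - a - b
  -- + ab` per sample. The joint one exceeds it by the normalized `pairCover` minus `ab`, and `ab ≥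
  -- 0` is dropped.
  refine pow_sub_pow_le (by linarith) (by linarith) (mul_nonneg (by linarith) (by linarith))
    (mul_le_one₀ (by linarith) (by linarith) (by linarith)) e4 ?_ q
  nlinarith [mul_nonneg e0 e1]

end CMK

/-! ### The weights of the surviving items -/

namespace CMK

variable {I : Type*} [Fintype I] [DecidableEq I] {P : CMK I}

theorem cover_le_size (x : P.FracSol) (i : I) : P.cover x i ≤ P.size x :=
  Finset.sum_le_sum_of_subset_of_nonneg (Finset.filter_subset _ _)
    fun _ _ _ => NNReal.coe_nonneg _

/-- The double sum equals `∑ C, x C * y(C) ^ 2`, where each `y(C)` is at most `τ`. This is what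
keeps the variance proportional to the number of samples and independent of the number of items. -/
theorem sum_mul_pairCover_le (x : P.FracSol) {y : I → ℝ} (hy : ∀ i, 0 ≤ y i) {τ : ℝ}
    (hτ : ∀ C : P.Config, ∑ i ∈ C.1, y i ≤ τ) :
    ∑ i, ∑ j, y i * y j * pairCover x i j ≤ P.size x * τ ^ 2 := by
  have h : ∑ i, ∑ j, y i * y j * pairCover x i j
      = ∑ C, (x C : ℝ) * (∑ i ∈ C.1, y i) ^ 2 := by
    have e : ∀ C : P.Config, (x C : ℝ) * (∑ i ∈ C.1, y i) ^ 2 = ∑ i, ∑ j, (x C : ℝ) *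
        ((y i * if i ∈ C.1 then 1 else 0) * (y j * if j ∈ C.1 then 1 else 0)) := by
      intro C
      have : ∑ i ∈ C.1, y i = ∑ i, y i * if i ∈ C.1 then 1 else 0 := by simp
      rw [this, sq, Finset.sum_mul_sum, Finset.mul_sum]
      simp only [Finset.mul_sum]
    simp only [e, pairCover, Finset.mul_sum]
    rw [Finset.sum_comm (s := (Finset.univ : Finset P.Config))]
    refine Finset.sum_congr rfl fun i _ => ?_
    rw [Finset.sum_comm (s := (Finset.univ : Finset P.Config))]
    exact Finset.sum_congr rfl fun j _ => Finset.sum_congr rfl fun C _ => by ring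
  rw [h, size, Finset.sum_mul]
  refine Finset.sum_le_sum fun C _ => mul_le_mul_of_nonneg_left ?_ (NNReal.coe_nonneg _)
  exact pow_le_pow_left₀ (Finset.sum_nonneg fun i _ => hy i) (hτ C) 2

/-- The probability that `q` samples miss the item `i`. -/
noncomputable def missProb (x : P.FracSol) (q : ℕ) (i : I) : ℝ :=
  (1 - P.cover x i / P.size x) ^ q

/-- Bernoulli's inequality. It makes the rescaling factor in `thin` at most `1`, so that weights
stay in `[0, 1]`. -/
theorem le_missProb {x : P.FracSol} (hx : 0 < P.size x) {i : I} (hc : P.cover x i ≤ 1) (q : ℕ) :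
    1 - q / P.size x ≤ missProb x q i := by
  have h1 : P.cover x i / P.size x ≤ 1 := (div_le_one hx).2 (cover_le_size x i)
  have h2 := one_add_mul_le_pow (a := -(P.cover x i / P.size x)) (by linarith) q
  have h3 : (q : ℝ) * (P.cover x i / P.size x) ≤ q / P.size x := by
    rw [← mul_div_assoc]
    gcongr
    exact mul_le_of_le_one_right (Nat.cast_nonneg _) hc
  rw [missProb, sub_eq_add_neg 1 (P.cover x i / P.size x)]
  linarith

/-- The weights after one iteration: items that were hit get weight zero, and the others are
rescaled so that every expected weight is multiplied by `1 - q / ‖x‖`. -/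
noncomputable def thin {q : ℕ} (x : P.FracSol) (z : I → ℝ) (r : Fin q → P.Config) (i : I) : ℝ :=
  z i * ((1 - q / P.size x) / missProb x q i) * missed r i

section Step

variable {x : P.FracSol} {q : ℕ} {z : I → ℝ}

theorem missed_mem (r : Fin q → P.Config) (i : I) : 0 ≤ missed r i ∧ missed r i ≤ 1 := by
  unfold missed
  split_ifs <;> simp

theorem thin_factor_mem (hq : (q : ℝ) < P.size x) (hc : ∀ i, P.cover x i ≤ 1) (i : I) :
    0 ≤ (1 - q / P.size x) / missProb x q i ∧ (1 - q / P.size x) / missProb x q i ≤ 1 := by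
  have hx : 0 < P.size x := (Nat.cast_nonneg q).trans_lt hq
  have h1 : 0 < 1 - q / P.size x := sub_pos.2 ((div_lt_one hx).2 hq)
  have h2 := le_missProb hx (hc i) q
  exact ⟨div_nonneg h1.le (h1.le.trans h2), (div_le_one (h1.trans_le h2)).2 h2⟩

theorem thin_mem (hq : (q : ℝ) < P.size x) (hc : ∀ i, P.cover x i ≤ 1)
    (hz : ∀ i, 0 ≤ z i ∧ z i ≤ 1) (r : Fin q → P.Config) (i : I) :
    0 ≤ thin x z r i ∧ thin x z r i ≤ 1 := by
  obtain ⟨h1, h2⟩ := thin_factor_mem hq hc i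
  obtain ⟨h3, h4⟩ := missed_mem r i
  obtain ⟨h5, h6⟩ := hz i
  exact ⟨mul_nonneg (mul_nonneg h5 h1) h3,
    mul_le_one₀ (mul_le_one₀ h6 h1 h2) h3 h4⟩

theorem factor_mul_missProb (hq : (q : ℝ) < P.size x) (hc : ∀ i, P.cover x i ≤ 1) (i : I) :
    (1 - q / P.size x) / missProb x q i * missProb x q i = 1 - q / P.size x := by
  have hx : 0 < P.size x := (Nat.cast_nonneg q).trans_lt hq
  have h1 : 0 < 1 - q / P.size x := sub_pos.2 ((div_lt_one hx).2 hq)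
  exact div_mul_cancel₀ _ (h1.trans_le (le_missProb hx (hc i) q)).ne'

theorem expect_thin (hq : (q : ℝ) < P.size x) (hc : ∀ i, P.cover x i ≤ 1) (i : I) :
    (iidLaw (P.configLaw x) q).expect (fun r => thin x z r i) = z i * (1 - q / P.size x) := by
  have hx : 0 < P.size x := (Nat.cast_nonneg q).trans_lt hq
  simp only [thin]
  rw [PMF.expect_const_mul, expect_missed hx]
  change z i * ((1 - q / P.size x) / missProb x q i) * missProb x q i = _
  rw [mul_assoc, factor_mul_missProb hq hc]

/-- One iteration increases the variance of a linear functional by at most `q * τ ^ 2`, where `τ`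
bounds the functional on configurations. -/
theorem expect_sq_thin_le (hq : (q : ℝ) < P.size x) (hc : ∀ i, P.cover x i ≤ 1)
    (hz : ∀ i, 0 ≤ z i ∧ z i ≤ 1) {u : I → ℝ} (hu : ∀ i, 0 ≤ u i) {τ : ℝ}
    (hτ : ∀ C : P.Config, ∑ i ∈ C.1, u i ≤ τ) (c : ℝ) :
    (iidLaw (P.configLaw x) q).expect
        (fun r => (∑ i, u i * thin x z r i - (1 - q / P.size x) * c) ^ 2)
      ≤ (∑ i, u i * z i - c) ^ 2 + q * τ ^ 2 := by
  have hx : 0 < P.size x := (Nat.cast_nonneg q).trans_lt hq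
  set ρ : ℝ := 1 - q / P.size x with hρ
  set E := (iidLaw (P.configLaw x) q).expect with hE
  set y : I → ℝ := fun i => u i * z i * (ρ / missProb x q i) with hy
  have hρ0 : 0 < ρ := sub_pos.2 ((div_lt_one hx).2 hq)
  have hρ1 : ρ ≤ 1 := sub_le_self _ (div_nonneg (Nat.cast_nonneg _) hx.le)
  have hf := thin_factor_mem hq hc
  have hy0 : ∀ i, 0 ≤ y i := fun i => mul_nonneg (mul_nonneg (hu i) (hz i).1) (hf i).1
  -- The rescaled coefficients only shrink, so `τ` still bounds them on configurations.
  have hyu : ∀ i, y i ≤ u i := fun i =>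
    (mul_le_of_le_one_right (mul_nonneg (hu i) (hz i).1) (hf i).2).trans
      (mul_le_of_le_one_right (hu i) (hz i).2)
  have hya : ∀ i, y i * missProb x q i = ρ * (u i * z i) := fun i => by
    rw [hy]
    change u i * z i * (ρ / missProb x q i) * missProb x q i = _
    rw [mul_assoc, factor_mul_missProb hq hc, mul_comm]
  have hsum : ∀ r : Fin q → P.Config, ∑ i, u i * thin x z r i = ∑ i, y i * missed r i := fun r =>
    Finset.sum_congr rfl fun i _ => by simp only [thin, hy, ← hρ]; ring
  have hEY : E (fun r => ∑ i, y i * missed r i) = ρ * ∑ i, u i * z i := by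
    rw [hE, PMF.expect_sum, Finset.mul_sum]
    refine Finset.sum_congr rfl fun i _ => ?_
    rw [PMF.expect_const_mul, expect_missed hx, ← hya]
    rfl
  have hEY2 : E (fun r => (∑ i, y i * missed r i) ^ 2)
      ≤ (ρ * ∑ i, u i * z i) ^ 2 + q * τ ^ 2 := by
    have e1 : ∀ r : Fin q → P.Config, (∑ i, y i * missed r i) ^ 2
        = ∑ i, ∑ j, y i * y j * (missed r i * missed r j) := fun r => by
      rw [sq, Finset.sum_mul_sum]
      exact Finset.sum_congr rfl fun i _ => Finset.sum_congr rfl fun j _ => by ring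
    simp only [e1]
    rw [hE, PMF.expect_sum]
    simp only [PMF.expect_sum, PMF.expect_const_mul]
    calc ∑ i, ∑ j, y i * y j * (iidLaw (P.configLaw x) q).expect
            (fun r => missed r i * missed r j)
        ≤ ∑ i, ∑ j, ((y i * missProb x q i) * (y j * missProb x q j)
            + (q / P.size x) * (y i * y j * pairCover x i j)) := by
          refine Finset.sum_le_sum fun i _ => Finset.sum_le_sum fun j _ => ?_
          refine (mul_le_mul_of_nonneg_left (expect_missed_mul_le hx q i j (cover_le_size x i)
            (cover_le_size x j)) (mul_nonneg (hy0 i) (hy0 j))).trans_eq ?_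
          simp only [missProb]
          ring
      _ = (∑ i, y i * missProb x q i) ^ 2
            + (q / P.size x) * ∑ i, ∑ j, y i * y j * pairCover x i j := by
          rw [sq, Finset.sum_mul_sum]
          simp only [Finset.sum_add_distrib, Finset.mul_sum]
      _ ≤ (ρ * ∑ i, u i * z i) ^ 2 + (q / P.size x) * (P.size x * τ ^ 2) := by
          have e2 : ∑ i, y i * missProb x q i = ρ * ∑ i, u i * z i := by
            simp only [hya, Finset.mul_sum]
          rw [e2]
          gcongr
          exact sum_mul_pairCover_le x hy0 fun C =>
            (Finset.sum_le_sum fun i _ => hyu i).trans (hτ C)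
      _ = (ρ * ∑ i, u i * z i) ^ 2 + q * τ ^ 2 := by
          rw [← mul_assoc, div_mul_cancel₀ _ hx.ne']
  have hexp : ∀ r : Fin q → P.Config, (∑ i, u i * thin x z r i - ρ * c) ^ 2
      = ((∑ i, y i * missed r i) ^ 2 - (2 * ρ * c) * ∑ i, y i * missed r i) + (ρ * c) ^ 2 :=
    fun r => by rw [hsum]; ring
  simp only [hexp]
  rw [hE, PMF.expect_add, PMF.expect_sub, PMF.expect_const_mul, PMF.expect_const, ← hE, hEY]
  -- The second moment is the new variance plus `ρ ^ 2` times the old squared deviation, which does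
  -- not grow because `ρ ≤ 1`.
  have hfin : ρ ^ 2 * (∑ i, u i * z i - c) ^ 2 ≤ (∑ i, u i * z i - c) ^ 2 :=
    mul_le_of_le_one_left (sq_nonneg _) (pow_le_one₀ hρ0.le hρ1)
  nlinarith

end Step

/-! ### The survivors of several iterations -/

theorem packed_snoc {q j : ℕ} (h : P.History q j) (r : Fin q → P.Config) :
    P.packed (q := q) (j := j + 1) (Fin.snoc (α := fun _ => Fin q → P.Config) h r)
      = P.packed h ∪ hit r := by
  ext i
  simp only [packed, hit, Finset.mem_union, Finset.mem_biUnion, Finset.mem_univ, true_and]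
  constructor
  · rintro ⟨a, b, hb⟩
    induction a using Fin.lastCases with
    | last => exact Or.inr ⟨b, by simpa using hb⟩
    | cast a => exact Or.inl ⟨a, b, by simpa using hb⟩
  · rintro (⟨a, b, hb⟩ | ⟨b, hb⟩)
    · exact ⟨a.castSucc, b, by simpa using hb⟩
    · exact ⟨Fin.last j, b, by simpa using hb⟩

theorem expect_run_succ {q : ℕ} (X : P.LPRule q) (j : ℕ) (f : P.History q (j + 1) → ℝ) :
    (P.run X (j + 1)).expect f = (P.run X j).expect fun h =>
      (iidLaw (P.configLaw (X j h)) q).expect fun r =>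
        f (Fin.snoc (α := fun _ => Fin q → P.Config) h r) := by
  rw [run, PMF.expect_bind]
  simp only [PMF.expect_map]

/-- The items carry weights in `[0, 1]`, vanishing on packed items, whose expectation after `j`
iterations is exactly `1 - j * ε` and for which linear functionals concentrate. -/
theorem exists_survivor_weights {q N : ℕ} {ε : ℝ} (hε : 0 < ε) (hq : ε * P.m = q) {X : P.LPRule q}
    (hX : X.IsApprox ε N) :
    ∀ j ≤ N, j * ε < 1 → ∃ z : P.History q j → I → ℝ, (∀ h i, 0 ≤ z h i ∧ z h i ≤ 1) ∧
      (∀ h, ∀ i ∈ P.packed h, z h i = 0) ∧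
      (∀ i, (P.run X j).expect (fun h => z h i) = 1 - j * ε) ∧
      ∀ (u : I → ℝ) (τ : ℝ), (∀ i, 0 ≤ u i) → (∀ C : P.Config, ∑ i ∈ C.1, u i ≤ τ) →
        (P.run X j).expect (fun h => (∑ i, u i * z h i - (1 - j * ε) * ∑ i, u i) ^ 2)
          ≤ j * (q * τ ^ 2) := by
  intro j
  induction j with
  | zero =>
    intro _ _
    refine ⟨fun _ _ => 1, fun _ _ => ⟨zero_le_one, le_rfl⟩, ?_, ?_, ?_⟩
    · intro h i hi
      simp [packed] at hi
    · intro i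
      rw [PMF.expect_const]
      simp
    · intro u τ _ _
      simp only [mul_one, Nat.cast_zero, zero_mul, sub_zero, one_mul, sub_self]
      rw [PMF.expect_const]
      simp
  | succ j ih =>
    intro hjN hj
    push_cast at hj
    have hjε : 0 < 1 - j * ε := by nlinarith
    obtain ⟨z, hz, hz0, hzE, hzV⟩ := ih (by omega) (by linarith)
    have hfeas : ∀ h, P.LPFeasible (P.remaining h) (P.m * (1 - j * ε)) (X j h) :=
      fun h => (hX j (by omega) h).1
    have hm : (0 : ℝ) < P.m := Nat.cast_pos.2 P.m_pos
    have hlt : ∀ h, (q : ℝ) < P.size (X j h) := fun h => by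
      rw [(hfeas h).2.2, ← hq]
      nlinarith
    -- Since `‖x‖ = m (1 - jε)` whatever the history, the factors `1 - q / ‖x‖` are deterministic
    -- and telescope.
    have hρ : ∀ h, (1 - j * ε) * (1 - q / P.size (X j h)) = 1 - ((j + 1 : ℕ) : ℝ) * ε := fun h => by
      rw [(hfeas h).2.2, ← hq]
      field_simp
      push_cast
      ring
    let w : P.History q (j + 1) → I → ℝ := fun h =>
      thin (X j (Fin.init (α := fun _ => Fin q → P.Config) h))
        (z (Fin.init (α := fun _ => Fin q → P.Config) h)) (h (Fin.last j))
    have hw : ∀ (h : P.History q j) (r : Fin q → P.Config),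
        w (Fin.snoc (α := fun _ => Fin q → P.Config) h r) = thin (X j h) (z h) r := fun h r => by
      simp only [w, Fin.init_snoc, Fin.snoc_last]
    refine ⟨w, fun h i => thin_mem (hlt _) (hfeas _).1 (hz _) _ i, ?_, ?_, ?_⟩
    · intro h i hi
      rw [← Fin.snoc_init_self (α := fun _ => Fin q → P.Config) h] at hi ⊢
      rw [packed_snoc, Finset.mem_union] at hi
      rw [hw, thin]
      rcases hi with hi | hi
      · rw [hz0 _ i hi, zero_mul, zero_mul]
      · rw [missed, if_pos hi, mul_zero]
    · intro i
      rw [expect_run_succ]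
      simp only [hw]
      simp only [expect_thin (hlt _) (hfeas _).1]
      have : ∀ h, z h i * (1 - q / P.size (X j h))
          = z h i * ((1 - ((j + 1 : ℕ) : ℝ) * ε) / (1 - j * ε)) := fun h => by
        rw [← hρ h, mul_div_cancel_left₀ _ hjε.ne']
      simp only [this]
      rw [PMF.expect_mul_const, hzE, mul_div_cancel₀ _ hjε.ne']
    · intro u τ hu hτ
      rw [expect_run_succ]
      simp only [hw]
      calc _ ≤ (P.run X j).expect (fun h =>
            (∑ i, u i * z h i - (1 - j * ε) * ∑ i, u i) ^ 2 + q * τ ^ 2) := by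
            refine PMF.expect_mono _ fun h => ?_
            rw [← hρ h, mul_comm (1 - j * ε) (1 - q / P.size (X j h)), mul_assoc]
            exact expect_sq_thin_le (hlt _) (hfeas _).1 (hz _) hu hτ _
        _ ≤ j * (q * τ ^ 2) + q * τ ^ 2 := by
            rw [PMF.expect_add, PMF.expect_const]
            linarith [hzV u τ hu hτ]
        _ = ((j + 1 : ℕ) : ℝ) * (q * τ ^ 2) := by push_cast; ring

/-! ### Rounding weights by independent coins -/

/-- The probability that independent coins with success probabilities `z` select the set `T`. -/
noncomputable def coinProb (z : I → ℝ) (T : Finset I) : ℝ :=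
  (∏ i ∈ T, z i) * ∏ i ∈ Finset.univ \ T, (1 - z i)

section Coins

variable {z : I → ℝ}

theorem coinProb_nonneg (hz : ∀ i, 0 ≤ z i ∧ z i ≤ 1) (T : Finset I) : 0 ≤ coinProb z T :=
  mul_nonneg (Finset.prod_nonneg fun i _ => (hz i).1)
    (Finset.prod_nonneg fun i _ => sub_nonneg.2 (hz i).2)

/-- Expand the product of `z i + (1 - z i)` with the second term suppressed on `A`: exactly the sets
containing `A` remain. All moments needed below are instances with at most two items. -/
theorem sum_coinProb_subset (A : Finset I) :
    ∑ T, coinProb z T * (if A ⊆ T then 1 else 0) = ∏ i ∈ A, z i := by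
  have h := Finset.prod_add z (fun i => if i ∈ A then 0 else 1 - z i) (Finset.univ : Finset I)
  rw [Finset.powerset_univ] at h
  have e1 : ∏ i, (z i + if i ∈ A then 0 else 1 - z i) = ∏ i ∈ A, z i := by
    rw [← Finset.prod_subset (Finset.subset_univ A)]
    · exact Finset.prod_congr rfl fun i hi => by rw [if_pos hi, add_zero]
    · intro i _ hi
      rw [if_neg hi]
      ring
  rw [← e1, h]
  refine Finset.sum_congr rfl fun T _ => ?_
  rw [coinProb, mul_assoc]
  congr 1
  split_ifs with hA
  · rw [mul_one]
    exact Finset.prod_congr rfl fun i hi =>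
      (if_neg fun hi' => (Finset.mem_sdiff.1 hi).2 (hA hi')).symm
  · obtain ⟨i, hiA, hiT⟩ := Finset.not_subset.1 hA
    rw [mul_zero]
    symm
    exact Finset.prod_eq_zero (Finset.mem_sdiff.2 ⟨Finset.mem_univ i, hiT⟩) (if_pos hiA)

theorem sum_coinProb : ∑ T, coinProb z T = 1 := by
  have := sum_coinProb_subset (z := z) ∅
  simpa using this

theorem sum_coinProb_mem (i : I) : ∑ T, coinProb z T * (if i ∈ T then 1 else 0) = z i := by
  have := sum_coinProb_subset (z := z) {i}
  simpa using this

theorem sum_coinProb_mem_mem {i j : I} (hij : i ≠ j) :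
    ∑ T, coinProb z T * ((if i ∈ T then 1 else 0) * if j ∈ T then 1 else 0) = z i * z j := by
  have := sum_coinProb_subset (z := z) {i, j}
  rw [Finset.prod_pair hij] at this
  rw [← this]
  refine Finset.sum_congr rfl fun T _ => ?_
  congr 1
  simp only [Finset.insert_subset_iff, Finset.singleton_subset_iff]
  by_cases h1 : i ∈ T <;> by_cases h2 : j ∈ T <;> simp [h1, h2]

theorem sum_coinProb_mul_sum (u : I → ℝ) :
    ∑ T, coinProb z T * ∑ i ∈ T, u i = ∑ i, u i * z i := by
  have e : ∀ T : Finset I, ∑ i ∈ T, u i = ∑ i, u i * if i ∈ T then 1 else 0 := fun T => by simp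
  simp only [e, Finset.mul_sum]
  rw [Finset.sum_comm]
  refine Finset.sum_congr rfl fun i _ => ?_
  rw [← sum_coinProb_mem (z := z) i, Finset.mul_sum]
  exact Finset.sum_congr rfl fun T _ => by ring

/-- Squared bias plus variance: off the diagonal the coins are independent, and the diagonal adds at
most `u i ^ 2` per item. -/
theorem sum_coinProb_mul_sq_le (hz : ∀ i, 0 ≤ z i ∧ z i ≤ 1) {u : I → ℝ} (c : ℝ) :
    ∑ T, coinProb z T * (∑ i ∈ T, u i - c) ^ 2 ≤ (∑ i, u i * z i - c) ^ 2 + ∑ i, u i ^ 2 := by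
  have e : ∀ T : Finset I, ∑ i ∈ T, u i = ∑ i, u i * if i ∈ T then 1 else 0 := fun T => by simp
  have h2 : ∑ T, coinProb z T * (∑ i ∈ T, u i) ^ 2 ≤ (∑ i, u i * z i) ^ 2 + ∑ i, u i ^ 2 := by
    have e1 : ∑ T, coinProb z T * (∑ i ∈ T, u i) ^ 2
        = ∑ i, ∑ j, u i * u j * ∑ T, coinProb z T *
          ((if i ∈ T then 1 else 0) * if j ∈ T then 1 else 0) := by
      have : ∀ T : Finset I, coinProb z T * (∑ i ∈ T, u i) ^ 2 = ∑ i, ∑ j, u i * u j *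
          (coinProb z T * ((if i ∈ T then 1 else 0) * if j ∈ T then 1 else 0)) := fun T => by
        rw [e, sq, Finset.sum_mul_sum, Finset.mul_sum]
        refine Finset.sum_congr rfl fun i _ => ?_
        rw [Finset.mul_sum]
        exact Finset.sum_congr rfl fun j _ => by ring
      simp only [this, Finset.mul_sum]
      rw [Finset.sum_comm]
      refine Finset.sum_congr rfl fun i _ => ?_
      rw [Finset.sum_comm]
    rw [e1, sq, Finset.sum_mul_sum, ← Finset.sum_add_distrib]
    refine Finset.sum_le_sum fun i _ => ?_
    have e2 : u i ^ 2 = ∑ j, if i = j then u i ^ 2 else 0 := by simp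
    rw [e2, ← Finset.sum_add_distrib]
    refine Finset.sum_le_sum fun j _ => ?_
    by_cases hij : i = j
    · subst hij
      have e3 : ∀ T : Finset I, ((if i ∈ T then (1 : ℝ) else 0) * if i ∈ T then 1 else 0)
          = if i ∈ T then 1 else 0 := fun T => by split_ifs <;> simp
      simp only [e3, sum_coinProb_mem, if_true]
      nlinarith [mul_nonneg (sq_nonneg (u i)) (sub_nonneg.2 (hz i).2), sq_nonneg (u i * z i)]
    · rw [sum_coinProb_mem_mem hij, if_neg hij]
      exact le_of_eq (by ring)
  have hexp : ∀ T : Finset I, coinProb z T * (∑ i ∈ T, u i - c) ^ 2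
      = coinProb z T * (∑ i ∈ T, u i) ^ 2 - (2 * c) * (coinProb z T * ∑ i ∈ T, u i)
        + coinProb z T * c ^ 2 := fun T => by ring
  simp only [hexp, Finset.sum_add_distrib, Finset.sum_sub_distrib, ← Finset.mul_sum,
    ← Finset.sum_mul, sum_coinProb_mul_sum, sum_coinProb]
  nlinarith

end Coins

/-- A random set of unpacked items that contains every item with probability exactly
`1 - j * ε` and on which linear functionals concentrate. -/
theorem exists_survivor_law {q N : ℕ} {ε : ℝ} (hε : 0 < ε) (hq : ε * P.m = q) {X : P.LPRule q}
    (hX : X.IsApprox ε N) {j : ℕ} (hjN : j ≤ N) (hj : j * ε < 1) :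
    ∃ κ : P.History q j → Finset I → ℝ, (∀ h T, 0 ≤ κ h T) ∧ (∀ h, ∑ T, κ h T = 1) ∧
      (∀ h T, κ h T ≠ 0 → T ⊆ P.remaining h) ∧
      (∀ u : I → ℝ, (P.run X j).expect (fun h => ∑ T, κ h T * ∑ i ∈ T, u i)
        = (1 - j * ε) * ∑ i, u i) ∧
      ∀ (u : I → ℝ) (τ : ℝ), (∀ i, 0 ≤ u i) → (∀ C : P.Config, ∑ i ∈ C.1, u i ≤ τ) →
        ∑ i, u i ≤ P.m * τ →
        (P.run X j).expect (fun h => ∑ T, κ h T * (∑ i ∈ T, u i - (1 - j * ε) * ∑ i, u i) ^ 2)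
          ≤ 2 * (P.m * τ ^ 2) := by
  obtain ⟨z, hz, hz0, hzE, hzV⟩ := exists_survivor_weights hε hq hX j hjN hj
  refine ⟨fun h => coinProb (z h), fun h => coinProb_nonneg (hz h), fun h => sum_coinProb, ?_, ?_,
    ?_⟩
  · intro h T hT i hi
    refine Finset.mem_sdiff.2 ⟨Finset.mem_univ i, fun hp => hT ?_⟩
    change (∏ i ∈ T, z h i) * _ = 0
    rw [Finset.prod_eq_zero hi (hz0 h i hp), zero_mul]
  · intro u
    simp only [sum_coinProb_mul_sum]
    rw [PMF.expect_sum]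
    simp only [PMF.expect_const_mul, hzE]
    rw [← Finset.sum_mul, mul_comm]
  · intro u τ hu hτ hm
    -- Singletons are configurations, so `u i ≤ τ`; hence the coins contribute at most `τ * ∑ i, u i
    -- ≤ m * τ ^ 2`.
    have hsingle : ∀ i, u i ^ 2 ≤ τ * u i := fun i => by
      have hi : u i ≤ τ := by
        have hC : P.IsConfig {i} := ⟨by simpa using Nat.succ_le_of_lt P.k_pos, by simpa using P.w_le_one i⟩
        simpa using hτ ⟨{i}, hC⟩
      rw [sq]
      exact mul_le_mul_of_nonneg_right hi (hu i)
    have hτ0 : 0 ≤ τ := by simpa [emptyConfig] using hτ P.emptyConfig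
    have hsq : ∑ i, u i ^ 2 ≤ P.m * τ ^ 2 := by
      calc ∑ i, u i ^ 2 ≤ ∑ i, τ * u i := Finset.sum_le_sum fun i _ => hsingle i
        _ = τ * ∑ i, u i := by rw [Finset.mul_sum]
        _ ≤ τ * (P.m * τ) := mul_le_mul_of_nonneg_left hm hτ0
        _ = P.m * τ ^ 2 := by ring
    -- All `j` batches together contain `jεm ≤ m` samples.
    have hjq : (j : ℝ) * (q * τ ^ 2) ≤ P.m * τ ^ 2 := by
      rw [← hq, ← mul_assoc]
      refine mul_le_mul_of_nonneg_right ?_ (sq_nonneg τ)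
      rw [← mul_assoc]
      exact mul_le_of_le_one_left (Nat.cast_nonneg _) hj.le
    refine (PMF.expect_mono _ fun h => sum_coinProb_mul_sq_le (hz h) _).trans ?_
    rw [PMF.expect_add, PMF.expect_const]
    linarith [hzV u τ hu hτ]

end CMK

/-! ### Sorting items by decreasing weight -/

section Rank

variable {I : Type*} [DecidableEq I]

/-- `e` enumerates `A` by decreasing weight, starting from `0`. -/
structure IsRank (A : Finset I) (w : I → ℝ) (e : I → ℕ) : Prop where
  image_eq : A.image e = Finset.range A.card
  anti : ∀ i ∈ A, ∀ j ∈ A, e i < e j → w j ≤ w i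

theorem exists_isRank (A : Finset I) (w : I → ℝ) : ∃ e, IsRank A w e := by
  induction A using Finset.induction_on_min_value w with
  | empty => exact ⟨fun _ => 0, by simp, by simp⟩
  | insert a A ha hw ih =>
    obtain ⟨e, he, hanti⟩ := ih
    have hlt : ∀ i ∈ A, e i < A.card := fun i hi =>
      Finset.mem_range.1 (he ▸ Finset.mem_image_of_mem e hi)
    have hne : ∀ i ∈ A, i ≠ a := fun i hi h => ha (h ▸ hi)
    refine ⟨Function.update e a A.card, ?_, ?_⟩
    · rw [Finset.image_insert, Function.update_self, Finset.card_insert_of_notMem ha,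
        Finset.range_add_one, ← he]
      congr 1
      exact Finset.image_congr fun i hi => Function.update_of_ne (hne i hi) _ _
    · intro i hi j hj hij
      rcases Finset.mem_insert.1 hi with rfl | hiA
      · rcases Finset.mem_insert.1 hj with rfl | hjA
        · exact le_rfl
        · rw [Function.update_self, Function.update_of_ne (hne j hjA)] at hij
          exact absurd hij (hlt j hjA).not_gt
      · rcases Finset.mem_insert.1 hj with rfl | hjA
        · exact hw i hiA
        · rw [Function.update_of_ne (hne i hiA), Function.update_of_ne (hne j hjA)] at hij
          exact hanti i hiA j hjA hij

namespace IsRank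

variable {A : Finset I} {w : I → ℝ} {e : I → ℕ}

theorem injOn (h : IsRank A w e) : Set.InjOn e A := by
  rw [← Finset.card_image_iff, h.image_eq, Finset.card_range]

theorem lt (h : IsRank A w e) {i : I} (hi : i ∈ A) : e i < A.card :=
  Finset.mem_range.1 (h.image_eq ▸ Finset.mem_image_of_mem e hi)

/-- The `t`-th block of `s` consecutive items. -/
def block (A : Finset I) (e : I → ℕ) (s t : ℕ) : Finset I := A.filter fun i => e i / s = t

theorem mem_block {s t : ℕ} {i : I} : i ∈ block A e s t ↔ i ∈ A ∧ e i / s = t :=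
  Finset.mem_filter

theorem card_block_le (h : IsRank A w e) {s : ℕ} (hs : 0 < s) (t : ℕ) :
    (block A e s t).card ≤ s := by
  have hinj : Set.InjOn (fun i => e i % s) (block A e s t) := by
    intro i hi j hj hij
    have hi' := mem_block.1 hi
    have hj' := mem_block.1 hj
    refine h.injOn hi'.1 hj'.1 ?_
    rw [← Nat.div_add_mod (e i) s, ← Nat.div_add_mod (e j) s, hi'.2, hj'.2]
    simp only at hij
    rw [hij]
  have := Finset.card_le_card_of_injOn (t := Finset.range s) (fun i => e i % s)
    (fun i _ => Finset.mem_coe.2 (Finset.mem_range.2 (Nat.mod_lt _ hs))) hinj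
  simpa using this

theorem card_block_eq (h : IsRank A w e) {s : ℕ} (hs : 0 < s) {t : ℕ} {j : I} (hj : j ∈ A)
    (hjt : t + 1 ≤ e j / s) : (block A e s t).card = s := by
  refine (h.card_block_le hs t).antisymm ?_
  have hsub : (Finset.range s).image (fun x => s * t + x) ⊆ (block A e s t).image e := by
    intro y hy
    obtain ⟨x, hx, rfl⟩ := Finset.mem_image.1 hy
    have hx := Finset.mem_range.1 hx
    have h1 : s * t + x < A.card := by
      have h2 : s * (t + 1) ≤ e j := (Nat.mul_le_mul_left s hjt).trans (Nat.mul_div_le _ _)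
      have := h.lt hj
      rw [mul_add, mul_one] at h2
      omega
    rw [← Finset.mem_range, ← h.image_eq] at h1
    obtain ⟨i, hi, hie⟩ := Finset.mem_image.1 h1
    refine Finset.mem_image.2 ⟨i, mem_block.2 ⟨hi, ?_⟩, hie⟩
    rw [hie, Nat.mul_add_div hs, Nat.div_eq_of_lt hx, add_zero]
  have h1 := (Finset.card_le_card hsub).trans Finset.card_image_le
  rwa [Finset.card_image_of_injective _ (add_right_injective _), Finset.card_range] at h1

/-- A block followed by a nonempty one is full. -/
theorem card_block_succ_le (h : IsRank A w e) {s : ℕ} (hs : 0 < s) (t : ℕ) :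
    (block A e s (t + 1)).card ≤ (block A e s t).card := by
  rcases (block A e s (t + 1)).eq_empty_or_nonempty with h0 | ⟨j, hj⟩
  · simp [h0]
  · rw [mem_block] at hj
    rw [h.card_block_eq hs hj.1 hj.2.ge]
    exact h.card_block_le hs _

theorem weight_le_of_block_lt (h : IsRank A w e) {s : ℕ} {i j : I} (hi : i ∈ A)
    (hj : j ∈ A) (hij : e i / s < e j / s) : w j ≤ w i :=
  h.anti i hi j hj (Nat.lt_of_div_lt_div hij)

/-- `θ t` separates block `t` from block `t + 1`: it is the largest weight in block `t + 1`, or `0`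
if that block is empty. A slot of size `θ t` is thus no larger than any item of block `t`, yet holds
any item of block `t + 1`. -/
theorem exists_threshold (h : IsRank A w e) (hw : ∀ i, 0 ≤ w i) (s : ℕ) :
    ∃ θ : ℕ → ℝ, (∀ t, 0 ≤ θ t) ∧ (∀ i ∈ A, θ (e i / s) ≤ w i) ∧
      ∀ i ∈ A, ∀ t, e i / s = t + 1 → w i ≤ θ t := by
  have key : ∀ t, ∃ x : ℝ, 0 ≤ x ∧ (∀ i ∈ A, e i / s = t → x ≤ w i) ∧
      ∀ i ∈ A, e i / s = t + 1 → w i ≤ x := by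
    intro t
    rcases (block A e s (t + 1)).eq_empty_or_nonempty with h0 | hne
    · refine ⟨0, le_rfl, fun i _ _ => hw i, fun i hi ht => ?_⟩
      exact absurd (mem_block.2 ⟨hi, ht⟩) (h0 ▸ Finset.notMem_empty i)
    · obtain ⟨j, hj, hmax⟩ := Finset.exists_max_image _ w hne
      rw [mem_block] at hj
      exact ⟨w j, hw j, fun i hi ht => h.weight_le_of_block_lt (s := s) hi hj.1 (by omega),
        fun i hi ht => hmax i (mem_block.2 ⟨hi, ht⟩)⟩
  choose θ h0 h1 h2 using key
  exact ⟨θ, h0, fun i hi => h1 _ i hi rfl, fun i hi t ht => h2 t i hi ht⟩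

/-- An item is at most as heavy as the average item of the block before its own. -/
theorem card_block_mul_le (h : IsRank A w e) {s : ℕ} {t : ℕ} {j : I} (hj : j ∈ A)
    (hjt : e j / s = t + 1) : (block A e s t).card * w j ≤ ∑ i ∈ block A e s t, w i := by
  rw [← nsmul_eq_mul]
  refine Finset.card_nsmul_le_sum _ _ _ fun i hi => ?_
  rw [mem_block] at hi
  exact h.weight_le_of_block_lt (s := s) hi.1 hj (by omega)

end IsRank

/-- Sorted round robin: `N` bins receive almost equal numbers of items, and after removal of one
item from each bin, no bin has more than the average weight. -/
theorem exists_roundRobin (A : Finset I) {w : I → ℝ} (hw : ∀ i, 0 ≤ w i) {N : ℕ} (hN : 0 < N) :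
    ∃ (f : I → ℕ) (D : Finset I), D ⊆ A ∧ D.card ≤ N ∧ (∀ i, f i < N) ∧
      (∀ b c, A.card ≤ N * c → (A.filter fun i => f i = b).card ≤ c) ∧
      (∀ b, (D.filter fun i => f i = b).card ≤ 1) ∧
      ∀ b, N * ∑ i ∈ (A \ D).filter (fun i => f i = b), w i ≤ ∑ i ∈ A, w i := by
  obtain ⟨e, he⟩ := exists_isRank A w
  have hinj : ∀ b, Set.InjOn (fun i => e i / N) (A.filter fun i => e i % N = b) := by
    intro b i hi j hj hij
    rw [Finset.mem_coe, Finset.mem_filter] at hi hj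
    refine he.injOn hi.1 hj.1 ?_
    simp only at hij
    rw [← Nat.div_add_mod (e i) N, ← Nat.div_add_mod (e j) N, hi.2, hj.2, hij]
  -- The item of rank `e` goes to bin `e % N` in round `e / N`; the removed items are those of the
  -- first round.
  refine ⟨fun i => e i % N, IsRank.block A e N 0, Finset.filter_subset _ _,
    he.card_block_le hN 0, fun i => Nat.mod_lt _ hN, ?_, ?_, ?_⟩
  · intro b c hc
    have := Finset.card_le_card_of_injOn (t := Finset.range c) (fun i => e i / N)
      (fun i hi => ?_) (hinj b)
    · simpa using this
    · rw [Finset.mem_coe, Finset.mem_filter] at hi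
      rw [Finset.mem_coe, Finset.mem_range, Nat.div_lt_iff_lt_mul hN, mul_comm]
      exact (he.lt hi.1).trans_le hc
  · intro b
    refine Finset.card_le_one.2 fun i hi j hj => ?_
    rw [Finset.mem_filter, IsRank.mem_block] at hi hj
    refine hinj b ?_ ?_ (hi.1.2.trans hj.1.2.symm)
    · exact Finset.mem_coe.2 (Finset.mem_filter.2 ⟨hi.1.1, hi.2⟩)
    · exact Finset.mem_coe.2 (Finset.mem_filter.2 ⟨hj.1.1, hj.2⟩)
  · intro b
    set F := (A \ IsRank.block A e N 0).filter fun i => e i % N = b with hF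
    have hmem : ∀ i ∈ F, i ∈ A ∧ e i % N = b ∧ e i / N ≠ 0 := by
      intro i hi
      rw [hF, Finset.mem_filter, Finset.mem_sdiff, IsRank.mem_block] at hi
      exact ⟨hi.1.1, hi.2, fun h => hi.1.2 ⟨hi.1.1, h⟩⟩
    calc (N : ℝ) * ∑ i ∈ F, w i = ∑ i ∈ F, (N : ℝ) * w i := Finset.mul_sum _ _ _
      -- Charge `N * w i` to the whole preceding round. A bin gets one item per round at most, so no
      -- round is charged twice.
      _ ≤ ∑ i ∈ F, ∑ j ∈ A, if e j / N + 1 = e i / N then w j else 0 := by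
          refine Finset.sum_le_sum fun i hi => ?_
          obtain ⟨hiA, -, hi0⟩ := hmem i hi
          obtain ⟨t, ht⟩ := Nat.exists_eq_succ_of_ne_zero hi0
          have h1 := he.card_block_mul_le hiA ht
          rw [he.card_block_eq hN hiA ht.ge] at h1
          rw [← Finset.sum_filter]
          refine h1.trans_eq (Finset.sum_congr ?_ fun _ _ => rfl)
          ext j
          rw [IsRank.mem_block, Finset.mem_filter, ht, Nat.succ_eq_add_one, add_left_inj]
      _ = ∑ j ∈ A, ∑ i ∈ F, if e j / N + 1 = e i / N then w j else 0 := Finset.sum_comm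
      _ ≤ ∑ j ∈ A, w j := by
          refine Finset.sum_le_sum fun j _ => ?_
          rw [← Finset.sum_filter, Finset.sum_const, nsmul_eq_mul]
          refine mul_le_of_le_one_left (hw j) ?_
          rw [Nat.cast_le_one]
          refine Finset.card_le_one.2 fun i hi i' hi' => ?_
          rw [Finset.mem_filter] at hi hi'
          obtain ⟨h1, h2, -⟩ := hmem i hi.1
          obtain ⟨h1', h2', -⟩ := hmem i' hi'.1
          exact hinj b (Finset.mem_coe.2 (Finset.mem_filter.2 ⟨h1, h2⟩))
            (Finset.mem_coe.2 (Finset.mem_filter.2 ⟨h1', h2'⟩)) (hi.2.symm.trans hi'.2)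

/-- The `+ 1` pays for rounding `y` down to an integer. -/
theorem exists_subset_card_le (X : Finset I) {y d : ℝ} (hy : 0 ≤ y) (hd : 0 ≤ d)
    (h : (X.card : ℝ) ≤ y + d) :
    ∃ Y ⊆ X, (Y.card : ℝ) ≤ y ∧ ((X \ Y).card : ℝ) ≤ d + 1 := by
  obtain ⟨Y, hYX, hY⟩ := Finset.exists_subset_card_eq (min_le_left X.card ⌊y⌋₊)
  have hfl := Nat.floor_le hy
  have hlt := Nat.lt_floor_add_one y
  refine ⟨Y, hYX, ?_, ?_⟩
  · refine le_trans ?_ hfl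
    rw [hY]
    exact_mod_cast min_le_right _ _
  · rw [Finset.cast_card_sdiff hYX, hY]
    rcases le_total X.card ⌊y⌋₊ with h' | h'
    · rw [min_eq_left h']
      linarith
    · rw [min_eq_right h']
      linarith

/-- If a subset `T` takes about a fraction `p` of every block of `A`, then a few items can be
removed from `T` such that the rest takes at most a fraction `p` of the weight. -/
theorem exists_sparse_removal {A T : Finset I} {w : I → ℝ} (hw : ∀ i, 0 ≤ w i) {e : I → ℕ}
    (he : IsRank A w e) (hT : T ⊆ A) {σ K : ℕ} (hσ : 0 < σ) (hK : A.card ≤ K * σ) {p d : ℝ}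
    (hp : 0 ≤ p) (hd : 0 ≤ d)
    (h : ∀ t < K, ((T.filter fun i => e i / σ = t).card : ℝ)
      ≤ p * (IsRank.block A e σ t).card + d) :
    ∃ D ⊆ T, (D.card : ℝ) ≤ σ + K * (d + 1) ∧ ∑ i ∈ T \ D, w i ≤ p * ∑ i ∈ A, w i := by
  set X : ℕ → Finset I := fun t => T.filter fun i => e i / σ = t with hX
  have hK' : ∀ i ∈ A, e i / σ < K := fun i hi => by
    rw [Nat.div_lt_iff_lt_mul hσ]
    exact (he.lt hi).trans_le hK
  -- The kept part of block `t + 1` is compared with block `t`: it has at most `p` times as many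
  -- items, each no heavier than the average there. Removed are the first block and the excess in
  -- the later ones.
  have key : ∀ t, ∃ Y ⊆ X (t + 1), (Y.card : ℝ) ≤ p * (IsRank.block A e σ t).card ∧
      ((X (t + 1) \ Y).card : ℝ) ≤ d + 1 := by
    intro t
    refine exists_subset_card_le _ (by positivity) hd ?_
    by_cases ht : t + 1 < K
    · refine (h _ ht).trans ?_
      have := he.card_block_succ_le hσ t
      gcongr
    · have : X (t + 1) = ∅ := Finset.filter_eq_empty_iff.2 fun i hi hit =>
        ht (hit ▸ hK' i (hT hi))
      rw [this, Finset.card_empty, Nat.cast_zero]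
      positivity
  choose Y hYX hY hYd using key
  set D := X 0 ∪ (Finset.range K).biUnion fun t => X (t + 1) \ Y t with hD
  have hDT : D ⊆ T := by
    refine Finset.union_subset (Finset.filter_subset _ _) (Finset.biUnion_subset.2 fun t _ => ?_)
    exact Finset.sdiff_subset.trans (Finset.filter_subset _ _)
  refine ⟨D, hDT, ?_, ?_⟩
  · have h0 : ((X 0).card : ℝ) ≤ σ := by
      refine Nat.cast_le.2 ((Finset.card_le_card ?_).trans (he.card_block_le hσ 0))
      exact Finset.filter_subset_filter _ hT
    have h1 : (((Finset.range K).biUnion fun t => X (t + 1) \ Y t).card : ℝ) ≤ K * (d + 1) := by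
      calc _ ≤ ((∑ t ∈ Finset.range K, (X (t + 1) \ Y t).card : ℕ) : ℝ) :=
            Nat.cast_le.2 Finset.card_biUnion_le
        _ ≤ ∑ _t ∈ Finset.range K, (d + 1) := by
            push_cast
            exact Finset.sum_le_sum fun t _ => hYd t
        _ = K * (d + 1) := by rw [Finset.sum_const, Finset.card_range, nsmul_eq_mul]
    have h2 : (D.card : ℝ) ≤ (X 0).card
        + ((Finset.range K).biUnion fun t => X (t + 1) \ Y t).card := by
      exact_mod_cast Finset.card_union_le _ _
    linarith
  · have hsub : T \ D ⊆ (Finset.range K).biUnion Y := by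
      intro i hi
      obtain ⟨hiT, hiD⟩ := Finset.mem_sdiff.1 hi
      rw [hD, Finset.mem_union, not_or] at hiD
      have hne : e i / σ ≠ 0 := fun h0 => hiD.1 (Finset.mem_filter.2 ⟨hiT, h0⟩)
      obtain ⟨t, ht⟩ := Nat.exists_eq_succ_of_ne_zero hne
      have htK : t ∈ Finset.range K := Finset.mem_range.2 (by have := hK' i (hT hiT); omega)
      refine Finset.mem_biUnion.2 ⟨t, htK, ?_⟩
      by_contra hY'
      exact hiD.2 (Finset.mem_biUnion.2
        ⟨t, htK, Finset.mem_sdiff.2 ⟨Finset.mem_filter.2 ⟨hiT, ht⟩, hY'⟩⟩)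
    have hYA : ∀ t, ∀ j ∈ Y t, j ∈ A ∧ e j / σ = t + 1 := fun t j hj => by
      have := Finset.mem_filter.1 (hYX t hj)
      exact ⟨hT this.1, this.2⟩
    have hblock : ∀ t, ∑ j ∈ Y t, w j ≤ p * ∑ i ∈ IsRank.block A e σ t, w i := by
      intro t
      rcases (Y t).eq_empty_or_nonempty with h0 | ⟨j0, hj0⟩
      · rw [h0, Finset.sum_empty]
        exact mul_nonneg hp (Finset.sum_nonneg fun i _ => hw i)
      · set n := (IsRank.block A e σ t).card with hn
        have hn0 : (0 : ℝ) < n := by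
          rw [hn, he.card_block_eq hσ (hYA t j0 hj0).1 (hYA t j0 hj0).2.ge]
          exact_mod_cast hσ
        set W := ∑ i ∈ IsRank.block A e σ t, w i
        have hW : 0 ≤ W := Finset.sum_nonneg fun i _ => hw i
        have h1 : n * ∑ j ∈ Y t, w j ≤ (Y t).card * W := by
          rw [Finset.mul_sum, ← nsmul_eq_mul]
          exact Finset.sum_le_card_nsmul _ _ _ fun j hj =>
            he.card_block_mul_le (hYA t j hj).1 (hYA t j hj).2
        have h2 : ((Y t).card : ℝ) * W ≤ p * n * W := mul_le_mul_of_nonneg_right (hY t) hW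
        refine le_of_mul_le_mul_left ?_ hn0
        calc (n : ℝ) * ∑ j ∈ Y t, w j ≤ p * n * W := h1.trans h2
          _ = n * (p * W) := by ring
    calc ∑ i ∈ T \ D, w i ≤ ∑ i ∈ (Finset.range K).biUnion Y, w i :=
          Finset.sum_le_sum_of_subset_of_nonneg hsub fun i _ _ => hw i
      _ ≤ ∑ t ∈ Finset.range K, ∑ i ∈ Y t, w i := by
          rw [Finset.sum_biUnion]
          intro a _ b _ hab
          refine Finset.disjoint_left.2 fun i hi hi' => hab ?_
          have h1 := (hYA a i hi).2
          have h2 := (hYA b i hi').2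
          omega
      _ ≤ ∑ t ∈ Finset.range K, p * ∑ i ∈ IsRank.block A e σ t, w i :=
          Finset.sum_le_sum fun t _ => hblock t
      _ = p * ∑ i ∈ A, w i := by
          rw [← Finset.mul_sum]
          congr 1
          exact Finset.sum_fiberwise_of_maps_to
            (fun i hi => Finset.mem_range.2 (hK' i hi)) w

/-- Items can be distributed to boxes of given capacities such that the number of items left over
is the excess over the total capacity. -/
theorem exists_distribution {γ : Type*} [Fintype γ] [DecidableEq γ] (A : Finset I) (s : γ → ℕ) :
    ∃ φ : I → Option γ, (∀ c, (A.filter fun i => φ i = some c).card ≤ s c) ∧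
      (A.filter fun i => φ i = none).card ≤ A.card - ∑ c, s c := by
  induction A using Finset.induction_on with
  | empty => exact ⟨fun _ => none, by simp⟩
  | insert a A ha ih =>
    obtain ⟨φ, h1, h2⟩ := ih
    have hfil : ∀ o o' : Option γ, (insert a A).filter (fun i => Function.update φ a o i = o')
        = if o = o' then insert a (A.filter fun i => φ i = o') else A.filter fun i => φ i = o' := by
      intro o o'
      rw [Finset.filter_insert, Function.update_self]
      have : A.filter (fun i => Function.update φ a o i = o') = A.filter fun i => φ i = o' :=
        Finset.filter_congr fun i hi => by
          rw [Function.update_of_ne fun h : i = a => ha (h ▸ hi)]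
      rw [this]
    by_cases hc : ∃ c, (A.filter fun i => φ i = some c).card < s c
    · obtain ⟨c, hc⟩ := hc
      refine ⟨Function.update φ a (some c), fun c' => ?_, ?_⟩
      · rw [hfil]
        split_ifs with h
        · rw [← Option.some_injective _ h]
          exact (Finset.card_insert_le _ _).trans hc
        · exact h1 c'
      · rw [hfil, if_neg (by simp), Finset.card_insert_of_notMem ha]
        omega
    -- If no box has room, all capacity is used, so the new leftover item counts as genuine excess.
    · push Not at hc
      refine ⟨Function.update φ a none, fun c' => ?_, ?_⟩
      · rw [hfil, if_neg (by simp)]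
        exact h1 c'
      · rw [hfil, if_pos rfl, Finset.card_insert_of_notMem ha]
        have h3 : A.card = ∑ o : Option γ, (A.filter fun i => φ i = o).card :=
          Finset.card_eq_sum_card_fiberwise fun i _ => Finset.mem_coe.2 (Finset.mem_univ (φ i))
        rw [Fintype.sum_option] at h3
        have h4 : ∑ c, s c ≤ ∑ c, (A.filter fun i => φ i = some c).card :=
          Finset.sum_le_sum fun c _ => hc c
        have h5 := Finset.card_insert_le a (A.filter fun i => φ i = none)
        omega

end Rank

/-! ### Packing items into bins -/

namespace CMK

variable {I : Type*} [Fintype I] [DecidableEq I] {P : CMK I}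

theorem IsConfig.mono {C D : Finset I} (hD : P.IsConfig D) (h : C ⊆ D) : P.IsConfig C :=
  ⟨(Finset.card_le_card h).trans hD.1,
    (Finset.sum_le_sum_of_subset_of_nonneg h fun i _ _ => P.w_nonneg i).trans hD.2⟩

theorem isConfig_of_card_le_one {C : Finset I} (h : C.card ≤ 1) : P.IsConfig C := by
  refine ⟨h.trans P.k_pos, ?_⟩
  calc ∑ i ∈ C, P.w i ≤ C.card • (1 : ℝ) := Finset.sum_le_card_nsmul _ _ _ fun i _ => P.w_le_one i
    _ ≤ 1 := by simpa using h

/-- The items of `T` fit into `n` bins. -/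
def Packs (P : CMK I) (T : Finset I) (n : ℕ) : Prop :=
  ∃ f : I → ℕ, (∀ i ∈ T, f i < n) ∧ ∀ b, P.IsConfig (T.filter fun i => f i = b)

theorem Packs.mono {T T' : Finset I} {n n' : ℕ} (h : P.Packs T n) (hT : T' ⊆ T) (hn : n ≤ n') :
    P.Packs T' n' := by
  obtain ⟨f, h1, h2⟩ := h
  exact ⟨f, fun i hi => (h1 i (hT hi)).trans_le hn,
    fun b => (h2 b).mono (Finset.filter_subset_filter _ hT)⟩

theorem Packs.union {T T' : Finset I} {n n' : ℕ} (h : P.Packs T n) (h' : P.Packs T' n') :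
    P.Packs (T ∪ T') (n + n') := by
  obtain ⟨f, h1, h2⟩ := h
  obtain ⟨f', h1', h2'⟩ := h'
  refine ⟨fun i => if i ∈ T then f i else n + f' i, fun i hi => ?_, fun b => ?_⟩ <;> beta_reduce
  · by_cases hiT : i ∈ T
    · rw [if_pos hiT]
      exact (h1 i hiT).trans_le (Nat.le_add_right _ _)
    · rw [if_neg hiT]
      have := h1' i ((Finset.mem_union.1 hi).resolve_left hiT)
      omega
  · by_cases hb : b < n
    · refine (h2 b).mono fun i hi => ?_
      rw [Finset.mem_filter] at hi ⊢
      by_cases hiT : i ∈ T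
      · exact ⟨hiT, by simpa [hiT] using hi.2⟩
      · have := hi.2
        rw [if_neg hiT] at this
        omega
    · refine (h2' (b - n)).mono fun i hi => ?_
      rw [Finset.mem_filter] at hi ⊢
      by_cases hiT : i ∈ T
      · have := hi.2
        rw [if_pos hiT] at this
        have := h1 i hiT
        omega
      · have := hi.2
        rw [if_neg hiT] at this
        exact ⟨(Finset.mem_union.1 hi.1).resolve_left hiT, by omega⟩

theorem packs_empty (n : ℕ) : P.Packs ∅ n :=
  ⟨fun _ => 0, by simp, fun b => isConfig_of_card_le_one (by simp)⟩

theorem Packs.biUnion {γ : Type*} [DecidableEq γ] (S : Finset γ) {T : γ → Finset I} {n : γ → ℕ}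
    (h : ∀ c ∈ S, P.Packs (T c) (n c)) : P.Packs (S.biUnion T) (∑ c ∈ S, n c) := by
  induction S using Finset.induction_on with
  | empty => simpa using packs_empty 0
  | insert a S ha ih =>
    rw [Finset.biUnion_insert, Finset.sum_insert ha]
    exact (h a (Finset.mem_insert_self _ _)).union
      (ih fun c hc => h c (Finset.mem_insert_of_mem hc))

theorem packs_card (T : Finset I) : P.Packs T T.card := by
  obtain ⟨e, he⟩ := exists_isRank T P.w
  refine ⟨e, fun i hi => he.lt hi, fun b => isConfig_of_card_le_one ?_⟩
  refine Finset.card_le_one.2 fun i hi j hj => ?_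
  rw [Finset.mem_filter] at hi hj
  exact he.injOn hi.1 hj.1 (hi.2.trans hj.2.symm)

/-- Items of weight at most `1 / 4` fit into `N` bins if they are few and light enough. -/
theorem packs_of_small {Z : Finset I} {N : ℕ} (hN : 0 < N) (hcard : Z.card ≤ N * P.k)
    (hsmall : ∀ i ∈ Z, P.w i ≤ 1 / 4) (hw : ∑ i ∈ Z, P.w i ≤ N * (3 / 4)) : P.Packs Z N := by
  obtain ⟨f, D, hDZ, -, hf, hfc, hfD, hfw⟩ := exists_roundRobin Z P.w_nonneg hN
  refine ⟨f, fun i _ => hf i, fun b => ⟨hfc b _ hcard, ?_⟩⟩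
  have hN' : (0 : ℝ) < N := Nat.cast_pos.2 hN
  -- Round robin bounds a bin by the average `3 / 4` once its first item is set aside; putting that
  -- item back adds at most `1 / 4`.
  have h1 : ∑ i ∈ (Z \ D).filter (fun i => f i = b), P.w i ≤ 3 / 4 :=
    le_of_mul_le_mul_left ((hfw b).trans hw) hN'
  have h2 : ∑ i ∈ D.filter (fun i => f i = b), P.w i ≤ 1 / 4 := by
    calc _ ≤ (D.filter fun i => f i = b).card • (1 / 4 : ℝ) :=
          Finset.sum_le_card_nsmul _ _ _ fun i hi =>
            hsmall i (hDZ (Finset.mem_filter.1 hi).1)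
      _ ≤ 1 / 4 := by
          rw [nsmul_eq_mul]
          exact mul_le_of_le_one_left (by norm_num) (by exact_mod_cast hfD b)
  have h3 : Z.filter (fun i => f i = b)
      = (Z \ D).filter (fun i => f i = b) ∪ D.filter fun i => f i = b := by
    rw [← Finset.filter_union, Finset.sdiff_union_of_subset hDZ]
  rw [h3]
  have h4 := Finset.sum_union_inter (s₁ := (Z \ D).filter (fun i => f i = b))
    (s₂ := D.filter fun i => f i = b) (f := P.w)
  have h5 : 0 ≤ ∑ i ∈ (Z \ D).filter (fun i => f i = b) ∩ D.filter fun i => f i = b, P.w i :=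
    Finset.sum_nonneg fun i _ => P.w_nonneg i
  linarith

/-- Bins with `ν t` slots for items of weight at most `θ t` and with room for `κ` further items
of total weight `a` can be filled with any suitable number of items for the slots, and with small
items up to the total room, apart from one small item per bin. -/
theorem exists_packs_class {Q R : Finset I} (hQR : Disjoint Q R) {N K κ : ℕ} (hN : 0 < N)
    {g : I → ℕ} (hg : ∀ i ∈ Q, g i < K) {ν : ℕ → ℕ} {θ : ℕ → ℝ} (hθ : ∀ t, 0 ≤ θ t)
    (hQθ : ∀ i ∈ Q, P.w i ≤ θ (g i))
    (hQν : ∀ t < K, (Q.filter fun i => g i = t).card ≤ N * ν t) {a : ℝ}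
    (hRκ : R.card ≤ N * κ) (hRa : ∑ i ∈ R, P.w i ≤ N * a)
    (hk : ∑ t ∈ Finset.range K, ν t + κ ≤ P.k)
    (ha : ∑ t ∈ Finset.range K, ν t * θ t + a ≤ 1) :
    ∃ D ⊆ R, D.card ≤ N ∧ P.Packs (Q ∪ (R \ D)) N := by
  obtain ⟨f, D, hDR, hDN, hf, hfc, -, hfw⟩ := exists_roundRobin R P.w_nonneg hN
  -- Only the equal spread of the round robin is used for the slots; weights are controlled by `θ`.
  have key : ∀ t, ∃ f : I → ℕ, (∀ i, f i < N) ∧ ∀ b, t < K →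
      (Q.filter fun i => g i = t ∧ f i = b).card ≤ ν t := by
    intro t
    obtain ⟨f, D, -, -, hf, hfc, -, -⟩ :=
      exists_roundRobin (Q.filter fun i => g i = t) P.w_nonneg hN
    exact ⟨f, hf, fun b ht => by simpa only [Finset.filter_filter] using hfc b (ν t) (hQν t ht)⟩
  choose F hF hFc using key
  refine ⟨D, hDR, hDN, fun i => if i ∈ R then f i else F (g i) i, fun i _ => ?_, fun b => ?_⟩
  · beta_reduce
    split_ifs
    · exact hf i
    · exact hF _ i
  have hN' : (0 : ℝ) < N := Nat.cast_pos.2 hN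
  have hsub : (Q ∪ (R \ D)).filter (fun i => (if i ∈ R then f i else F (g i) i) = b)
      ⊆ (Finset.range K).biUnion (fun t => Q.filter fun i => g i = t ∧ F t i = b)
        ∪ (R \ D).filter fun i => f i = b := by
    intro i hi
    rw [Finset.mem_filter, Finset.mem_union] at hi
    rw [Finset.mem_union]
    rcases hi.1 with hiQ | hiR
    · refine Or.inl (Finset.mem_biUnion.2 ⟨g i, Finset.mem_range.2 (hg i hiQ),
        Finset.mem_filter.2 ⟨hiQ, rfl, ?_⟩⟩)
      have := hi.2
      rwa [if_neg (Finset.disjoint_left.1 hQR hiQ)] at this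
    · refine Or.inr (Finset.mem_filter.2 ⟨hiR, ?_⟩)
      have := hi.2
      rwa [if_pos (Finset.mem_sdiff.1 hiR).1] at this
  refine IsConfig.mono ⟨?_, ?_⟩ hsub
  · refine (Finset.card_union_le _ _).trans (le_trans (add_le_add ?_ ?_) hk)
    · exact Finset.card_biUnion_le.trans
        (Finset.sum_le_sum fun t ht => hFc t b (Finset.mem_range.1 ht))
    · exact (Finset.card_le_card (Finset.filter_subset_filter _ Finset.sdiff_subset)).trans
        (hfc b κ hRκ)
  · have h1 : ∑ i ∈ (R \ D).filter (fun i => f i = b), P.w i ≤ a :=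
      le_of_mul_le_mul_left ((hfw b).trans hRa) hN'
    have h2 : ∑ i ∈ (Finset.range K).biUnion (fun t => Q.filter fun i => g i = t ∧ F t i = b),
        P.w i ≤ ∑ t ∈ Finset.range K, ν t * θ t := by
      rw [Finset.sum_biUnion]
      · refine Finset.sum_le_sum fun t ht => ?_
        calc _ ≤ (Q.filter fun i => g i = t ∧ F t i = b).card • θ t :=
              Finset.sum_le_card_nsmul _ _ _ fun i hi => by
                rw [Finset.mem_filter] at hi
                rw [← hi.2.1]
                exact hQθ i hi.1
          _ ≤ ν t * θ t := by
              rw [nsmul_eq_mul]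
              exact mul_le_mul_of_nonneg_right
                (Nat.cast_le.2 (hFc t b (Finset.mem_range.1 ht))) (hθ t)
      · intro t _ t' _ htt'
        refine Finset.disjoint_left.2 fun i hi hi' => htt' ?_
        rw [Finset.mem_filter] at hi hi'
        exact hi.2.1.symm.trans hi'.2.1
    have h4 := Finset.sum_union_inter
      (s₁ := (Finset.range K).biUnion (fun t => Q.filter fun i => g i = t ∧ F t i = b))
      (s₂ := (R \ D).filter fun i => f i = b) (f := P.w)
    have h5 : 0 ≤ ∑ i ∈ (Finset.range K).biUnion (fun t => Q.filter fun i => g i = t ∧ F t i = b)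
        ∩ (R \ D).filter (fun i => f i = b), P.w i := Finset.sum_nonneg fun i _ => P.w_nonneg i
    linarith

end CMK

/-! ### Packing a sampled part of a fixed solution. -/

namespace CMK

variable {I : Type*} [Fintype I] [DecidableEq I] {P : CMK I}

theorem sum_biUnion_le_sum {γ : Type*} [DecidableEq γ] (S : Finset γ) (A : γ → Finset I)
    {u : I → ℝ} (hu : ∀ i, 0 ≤ u i) : ∑ i ∈ S.biUnion A, u i ≤ ∑ c ∈ S, ∑ i ∈ A c, u i := by
  induction S using Finset.induction_on with
  | empty => simp
  | insert a S ha ih =>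
    rw [Finset.biUnion_insert, Finset.sum_insert ha]
    have h1 := Finset.sum_union_inter (s₁ := A a) (s₂ := S.biUnion A) (f := u)
    have h2 : 0 ≤ ∑ i ∈ A a ∩ S.biUnion A, u i := Finset.sum_nonneg fun i _ => hu i
    linarith

/-- The sampled small items of a class of `mc` bins with room for `κ` small items of total weight
`a` fit into about `p * mc` such bins, up to few items of small total weight. -/
theorem exists_small_removal {U T : Finset I} (hT : T ⊆ U) {e : I → ℕ} (he : IsRank U P.w e)
    {σ K s mc κ N : ℕ} (hs : 0 < s) (hσ : 0 < σ) (hK : U.card ≤ K * σ) {a p h : ℝ} (ha : 0 ≤ a)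
    (hp : 0 ≤ p) (hh : 0 ≤ h) (hUκ : U.card ≤ mc * κ)
    (hUa : ∑ i ∈ U, P.w i ≤ mc * a) (hκ : U.Nonempty → P.k ≤ 2 * κ)
    (hN : p * mc + (s ^ 2 + 2) * h ≤ N)
    (hTw : ∑ i ∈ T, P.w i ≤ p * ∑ i ∈ U, P.w i + h)
    (hTc : (T.card : ℝ) ≤ p * U.card + P.k * h)
    (hTb : ∀ t < K, ((T.filter fun i => e i / σ = t).card : ℝ)
      ≤ p * (IsRank.block U e σ t).card + P.k * h) :
    ∃ D ⊆ T, (T \ D).card ≤ N * κ ∧ ∑ i ∈ T \ D, P.w i ≤ N * a ∧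
      (D.card : ℝ) ≤ σ + K * (P.k * h + 1) ∧ ∑ i ∈ D, P.w i ≤ mc / s ^ 2 := by
  have hs2 : (0 : ℝ) < (s : ℝ) ^ 2 := by positivity
  rcases T.eq_empty_or_nonempty with rfl | hne
  · refine ⟨∅, le_rfl, by simp, ?_, ?_, ?_⟩
    · simp only [Finset.empty_sdiff, Finset.sum_empty]
      positivity
    · simp only [Finset.card_empty, Nat.cast_zero]
      positivity
    · simp only [Finset.sum_empty]
      positivity
  -- The deviation `k * h` is at most `2 * κ * h`, so `2 * h` of the additional bins suffice for the
  -- number of items.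
  have hcard : T.card ≤ N * κ := by
    have h1 : (P.k : ℝ) ≤ 2 * κ := by exact_mod_cast hκ (hne.mono hT)
    have h2 : (U.card : ℝ) ≤ mc * κ := by exact_mod_cast hUκ
    have h3 : (T.card : ℝ) ≤ N * κ := by
      calc (T.card : ℝ) ≤ p * (mc * κ) + (2 * κ) * h := hTc.trans (by gcongr)
        _ ≤ (p * mc + (s ^ 2 + 2) * h) * κ := by
            have : 0 ≤ (s : ℝ) ^ 2 * h * κ := by positivity
            nlinarith
        _ ≤ N * κ := by gcongr
    exact_mod_cast h3
  have hpmc : p * mc ≤ N := by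
    have : 0 ≤ ((s : ℝ) ^ 2 + 2) * h := by positivity
    linarith
  -- If the room `a` is tiny, additional bins cannot absorb the weight deviation `h`, so items are
  -- removed, whose total weight is at most `mc * a`. Otherwise `s ^ 2 * h` additional bins provide
  -- room at least `h` and nothing is removed.
  by_cases has : a < 1 / s ^ 2
  · obtain ⟨D, hDT, hDc, hDw⟩ := exists_sparse_removal P.w_nonneg he hT hσ hK hp
      (by positivity : 0 ≤ (P.k : ℝ) * h) hTb
    refine ⟨D, hDT, (Finset.card_le_card Finset.sdiff_subset).trans hcard, ?_, hDc, ?_⟩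
    · calc _ ≤ p * (mc * a) := hDw.trans (by gcongr)
        _ = p * mc * a := by ring
        _ ≤ N * a := by gcongr
    · calc ∑ i ∈ D, P.w i ≤ ∑ i ∈ U, P.w i :=
            Finset.sum_le_sum_of_subset_of_nonneg (hDT.trans hT) fun i _ _ => P.w_nonneg i
        _ ≤ mc * (1 / s ^ 2) := hUa.trans (by gcongr)
        _ = mc / s ^ 2 := by ring
  · push Not at has
    refine ⟨∅, Finset.empty_subset _, by rwa [Finset.sdiff_empty], ?_, ?_, ?_⟩
    · rw [Finset.sdiff_empty]
      have h1 : 1 ≤ s ^ 2 * a := by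
        rwa [div_le_iff₀ hs2, mul_comm] at has
      calc _ ≤ p * (mc * a) + h * (s ^ 2 * a) := by
            refine hTw.trans (add_le_add (by gcongr) (le_mul_of_one_le_right hh h1))
        _ ≤ (p * mc + (s ^ 2 + 2) * h) * a := by
            have : 0 ≤ h * a := by positivity
            nlinarith
        _ ≤ N * a := by gcongr
    · simp only [Finset.card_empty, Nat.cast_zero]
      positivity
    · simp only [Finset.sum_empty]
      positivity

/-- The small items in the bins of class `c`. -/
def smallIn {γ : Type*} [DecidableEq γ] (O L : Finset I) (β : I → Fin P.m) (cls : Fin P.m → γ)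
    (c : γ) : Finset I := (O \ L).filter fun i => cls (β i) = c

section Sampled

variable {s q : ℕ} {O L : Finset I} {β : I → Fin P.m} {e : I → ℕ} {γ : Type*} [Fintype γ]
  [DecidableEq γ] {cls : Fin P.m → γ} {ν : γ → ℕ → ℕ} {K : ℕ} {p h : ℝ} {T : Finset I}

theorem card_fiber_large (hq : 0 < q) (he : IsRank L P.w e) (hK : L.card ≤ K * q)
    (hν : ∀ b t, (L.filter fun i => β i = b ∧ e i / q = t).card = ν (cls b) t) (b : Fin P.m) :
    (L.filter fun i => β i = b).card = ∑ t ∈ Finset.range K, ν (cls b) t := by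
  rw [Finset.card_eq_sum_card_fiberwise (f := fun i => e i / q) (t := Finset.range K)]
  · refine Finset.sum_congr rfl fun t _ => ?_
    rw [← hν b t, Finset.filter_filter]
  · intro i hi
    rw [Finset.mem_coe, Finset.mem_filter] at hi
    rw [Finset.mem_coe, Finset.mem_range, Nat.div_lt_iff_lt_mul hq]
    exact (he.lt hi.1).trans_le hK

/-- Slots of size `θ` cost no more than the large items they replace, so the small items of the bin
keep at least the room they had. -/
theorem le_weight_fiber_large (hq : 0 < q) (he : IsRank L P.w e) (hK : L.card ≤ K * q)
    (hν : ∀ b t, (L.filter fun i => β i = b ∧ e i / q = t).card = ν (cls b) t) {θ : ℕ → ℝ}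
    (hθ : ∀ i ∈ L, θ (e i / q) ≤ P.w i) (b : Fin P.m) :
    ∑ t ∈ Finset.range K, ν (cls b) t * θ t ≤ ∑ i ∈ L.filter (fun i => β i = b), P.w i := by
  rw [← Finset.sum_fiberwise_of_maps_to (g := fun i => e i / q) (t := Finset.range K)]
  · refine Finset.sum_le_sum fun t _ => ?_
    rw [← hν b t, ← nsmul_eq_mul, Finset.filter_filter]
    refine Finset.card_nsmul_le_sum _ _ _ fun i hi => ?_
    rw [Finset.mem_filter] at hi
    rw [← hi.2.2]
    exact hθ i hi.1
  · intro i hi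
    rw [Finset.mem_filter] at hi
    rw [Finset.mem_range, Nat.div_lt_iff_lt_mul hq]
    exact (he.lt hi.1).trans_le hK

theorem filter_sdiff_eq (b : Fin P.m) :
    (O \ L).filter (fun i => β i = b)
      = O.filter (fun i => β i = b) \ L.filter fun i => β i = b := by
  ext i
  simp only [Finset.mem_filter, Finset.mem_sdiff]
  tauto

theorem card_smallIn_le (hL : L ⊆ O) (hβ : ∀ b, P.IsConfig (O.filter fun i => β i = b)) {n : ℕ}
    {c : γ} (hn : ∀ b, cls b = c → (L.filter fun i => β i = b).card = n) :
    (smallIn O L β cls c).card ≤ (Finset.univ.filter fun b => cls b = c).card * (P.k - n) := by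
  rw [mul_comm]
  refine Finset.card_le_mul_card_image_of_maps_to (f := β) (fun i hi => ?_) _ fun b hb => ?_
  · exact Finset.mem_filter.2 ⟨Finset.mem_univ _, (Finset.mem_filter.1 hi).2⟩
  · have h1 : (smallIn O L β cls c).filter (fun i => β i = b)
        ⊆ (O \ L).filter fun i => β i = b := Finset.filter_subset_filter _ (Finset.filter_subset _ _)
    refine (Finset.card_le_card h1).trans ?_
    rw [filter_sdiff_eq, Finset.card_sdiff_of_subset (Finset.filter_subset_filter _ hL),
      hn b (Finset.mem_filter.1 hb).2]
    exact Nat.sub_le_sub_right (hβ b).1 _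

theorem weight_smallIn_le (hL : L ⊆ O) (hβ : ∀ b, P.IsConfig (O.filter fun i => β i = b)) {a : ℝ}
    {c : γ} (ha : ∀ b, cls b = c → 1 - a ≤ ∑ i ∈ L.filter (fun i => β i = b), P.w i) :
    ∑ i ∈ smallIn O L β cls c, P.w i ≤ (Finset.univ.filter fun b => cls b = c).card * a := by
  rw [← Finset.sum_fiberwise_of_maps_to (g := β) (t := Finset.univ.filter fun b => cls b = c),
    ← nsmul_eq_mul]
  · refine Finset.sum_le_card_nsmul _ _ _ fun b hb => ?_
    have h1 : (smallIn O L β cls c).filter (fun i => β i = b)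
        ⊆ (O \ L).filter fun i => β i = b := Finset.filter_subset_filter _ (Finset.filter_subset _ _)
    refine (Finset.sum_le_sum_of_subset_of_nonneg h1 fun i _ _ => P.w_nonneg i).trans ?_
    rw [filter_sdiff_eq]
    have h2 := Finset.sum_sdiff (f := P.w)
      (Finset.filter_subset_filter (fun i => β i = b) hL)
    have h3 := ha b (Finset.mem_filter.1 hb).2
    have h4 := (hβ b).2
    linarith
  · intro i hi
    exact Finset.mem_filter.2 ⟨Finset.mem_univ _, (Finset.mem_filter.1 hi).2⟩

/-- If `T` takes about a fraction `p` of every group of large items, then its large items, except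
those of the first group, can be distributed to the slots of the next heavier group of about `p`
times as many bins of each class, up to few exceptions. -/
theorem exists_slot_distribution (hq : 0 < q) (he : IsRank L P.w e)
    (hK : L.card ≤ K * q) (hTL : T ⊆ L)
    (hν : ∀ b t, (L.filter fun i => β i = b ∧ e i / q = t).card = ν (cls b) t)
    (hp : 0 ≤ p) (hh : 0 ≤ h)
    (hT : ∀ t < K, ((T.filter fun i => e i / q = t).card : ℝ)
      ≤ p * (IsRank.block L e q t).card + h)
    {N : γ → ℕ} (hN : ∀ c, p * (Finset.univ.filter fun b => cls b = c).card ≤ N c) :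
    ∃ φ : I → Option γ, (∀ c t, (T.filter fun i => e i / q = t + 1 ∧ φ i = some c).card
        ≤ N c * ν c t) ∧
      ((T.filter fun i => e i / q ≠ 0 ∧ φ i = none).card : ℝ) ≤ K * h := by
  have hlt : ∀ i ∈ L, e i / q < K := fun i hi => by
    rw [Nat.div_lt_iff_lt_mul hq]
    exact (he.lt hi).trans_le hK
  -- Group `t` has exactly as many items as there are slots for it in all bins; group `t + 1` is no
  -- larger, so a fraction `p` of it fits into these slots up to the deviation.
  have hblock : ∀ t, (IsRank.block L e q t).card
      = ∑ c, (Finset.univ.filter fun b => cls b = c).card * ν c t := by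
    intro t
    rw [Finset.card_eq_sum_card_fiberwise (f := β) (t := Finset.univ)
      fun i _ => Finset.mem_coe.2 (Finset.mem_univ _)]
    rw [← Finset.sum_fiberwise_of_maps_to (g := cls) (t := Finset.univ)
      fun i _ => Finset.mem_univ _]
    refine Finset.sum_congr rfl fun c _ => ?_
    rw [← smul_eq_mul]
    refine Finset.sum_eq_card_nsmul fun b hb => ?_
    rw [← (Finset.mem_filter.1 hb).2, ← hν b t, IsRank.block, Finset.filter_filter]
    exact congrArg _ (Finset.filter_congr fun i _ => and_comm)
  have key : ∀ t, ∃ φ : I → Option γ, (∀ c, (T.filter fun i => e i / q = t + 1 ∧ φ i = some c).card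
        ≤ N c * ν c t) ∧ ((T.filter fun i => e i / q = t + 1 ∧ φ i = none).card : ℝ) ≤ h := by
    intro t
    obtain ⟨φ, h1, h2⟩ := exists_distribution (T.filter fun i => e i / q = t + 1)
      fun c => N c * ν c t
    simp only [Finset.filter_filter] at h1 h2
    refine ⟨φ, h1, ?_⟩
    have h3 : ((T.filter fun i => e i / q = t + 1).card : ℝ) ≤ (∑ c, N c * ν c t : ℕ) + h := by
      by_cases ht : t + 1 < K
      · refine (hT _ ht).trans (add_le_add_left ?_ h)
        calc p * ((IsRank.block L e q (t + 1)).card : ℝ)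
            ≤ p * ((IsRank.block L e q t).card : ℝ) := by
              have := he.card_block_succ_le hq t
              gcongr
          _ = ∑ c, p * (Finset.univ.filter fun b => cls b = c).card * ν c t := by
              rw [hblock, Nat.cast_sum, Finset.mul_sum]
              exact Finset.sum_congr rfl fun c _ => by push_cast; ring
          _ ≤ (∑ c, N c * ν c t : ℕ) := by
              push_cast
              exact Finset.sum_le_sum fun c _ =>
                mul_le_mul_of_nonneg_right (hN c) (Nat.cast_nonneg _)
      · have : T.filter (fun i => e i / q = t + 1) = ∅ := Finset.filter_eq_empty_iff.2
          fun i hi hit => ht (hit ▸ hlt i (hTL hi))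
        rw [this, Finset.card_empty, Nat.cast_zero]
        positivity
    have h4 : ((T.filter fun i => e i / q = t + 1 ∧ φ i = none).card : ℝ)
        ≤ ((T.filter fun i => e i / q = t + 1).card - ∑ c, N c * ν c t : ℕ) := Nat.cast_le.2 h2
    refine h4.trans ?_
    rcases le_total (T.filter fun i => e i / q = t + 1).card (∑ c, N c * ν c t) with hle | hle
    · rw [Nat.sub_eq_zero_of_le hle, Nat.cast_zero]
      exact hh
    · rw [Nat.cast_sub hle]
      linarith
  choose φ h1 h2 using key
  -- Truncated subtraction also sends group `0` to `φ 0`, which is harmless: both claims concern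
  -- later groups only.
  refine ⟨fun i => φ (e i / q - 1) i, fun c t => ?_, ?_⟩
  · refine le_trans (Finset.card_le_card fun i hi => ?_) (h1 t c)
    rw [Finset.mem_filter] at hi ⊢
    refine ⟨hi.1, hi.2.1, ?_⟩
    simpa only [hi.2.1, Nat.add_sub_cancel] using hi.2.2
  · have hsub : T.filter (fun i => e i / q ≠ 0 ∧ φ (e i / q - 1) i = none)
        ⊆ (Finset.range K).biUnion fun t => T.filter fun i => e i / q = t + 1 ∧ φ t i = none := by
      intro i hi
      rw [Finset.mem_filter] at hi
      exact Finset.mem_biUnion.2 ⟨e i / q - 1,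
        Finset.mem_range.2 ((Nat.sub_le _ _).trans_lt (hlt i (hTL hi.1))), Finset.mem_filter.2
          ⟨hi.1, (Nat.sub_add_cancel (Nat.one_le_iff_ne_zero.2 hi.2.1)).symm, hi.2.2⟩⟩
    calc _ ≤ ((∑ t ∈ Finset.range K,
          (T.filter fun i => e i / q = t + 1 ∧ φ t i = none).card : ℕ) : ℝ) :=
          Nat.cast_le.2 ((Finset.card_le_card hsub).trans Finset.card_biUnion_le)
      _ ≤ ∑ _t ∈ Finset.range K, h := by
          push_cast
          exact Finset.sum_le_sum fun t _ => h2 t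
      _ = K * h := by rw [Finset.sum_const, Finset.card_range, nsmul_eq_mul]

/-- A set `T` of items of a solution that takes about a fraction `p` of every group of large items
and of the small items of every class of bins fits into little more than a fraction `p` of the
bins. -/
theorem exists_packs_of_sampled (hs : 2 ≤ s) (hq : 0 < q) (hm : P.m = q * s ^ 2)
    (hβ : ∀ b, P.IsConfig (O.filter fun i => β i = b)) (hL : L ⊆ O)
    (hsmall : ∀ i ∈ O \ L, P.w i ≤ 1 / s ^ 2 ∧ 2 * s ^ 2 ≤ P.k)
    (hlarge : 2 * s ^ 2 ≤ P.k → ∀ i ∈ L, 1 / (s : ℝ) ^ 2 < P.w i)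
    (he : IsRank L P.w e) (hK : L.card ≤ K * q) (hcls : Function.Surjective cls)
    (hν : ∀ b t, (L.filter fun i => β i = b ∧ e i / q = t).card = ν (cls b) t)
    {d : γ → I → ℕ} (hd : ∀ c, IsRank (smallIn O L β cls c) P.w (d c)) {σ K' : ℕ} (hσ : 0 < σ)
    (hK' : P.m * P.k ≤ K' * σ) (hp : 0 ≤ p) (hp1 : p ≤ 1) (hh : 0 < h) (hTO : T ⊆ O)
    (hTL : ∀ t < K, (((T ∩ L).filter fun i => e i / q = t).card : ℝ)
      ≤ p * (IsRank.block L e q t).card + 2 * s ^ 2 * h)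
    (hTw : ∀ c, ∑ i ∈ T ∩ smallIn O L β cls c, P.w i
      ≤ p * ∑ i ∈ smallIn O L β cls c, P.w i + h)
    (hTc : ∀ c, ((T ∩ smallIn O L β cls c).card : ℝ) ≤ p * (smallIn O L β cls c).card + P.k * h)
    (hTb : ∀ c, ∀ t < K', (((T ∩ smallIn O L β cls c).filter fun i => d c i / σ = t).card : ℝ)
      ≤ p * (IsRank.block (smallIn O L β cls c) (d c) σ t).card + P.k * h)
    (h1 : Fintype.card γ * ((s ^ 2 + 2) * h + 1) ≤ q) (h2 : K * (2 * s ^ 2 * h) ≤ q)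
    (h3 : Fintype.card γ * (σ + K' * (P.k * h + 1)) ≤ 3 * (P.k * q)) :
    ∃ n : ℕ, (n : ℝ) ≤ p * P.m + 8 * q ∧ P.Packs T n := by
  have hs2 : (0 : ℝ) < (s : ℝ) ^ 2 := by positivity
  obtain ⟨θ, hθ0, hθ1, hθ2⟩ := he.exists_threshold P.w_nonneg q
  set mc : γ → ℕ := fun c => (Finset.univ.filter fun b => cls b = c).card with hmc
  set U : γ → Finset I := smallIn O L β cls with hU
  -- The surplus splits into `s ^ 2 * h` bins for the weight deviation and `2 * h` for the
  -- cardinality deviation of small items.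
  set N : γ → ℕ := fun c => ⌈p * mc c + (s ^ 2 + 2) * h⌉₊ with hNdef
  set n : γ → ℕ := fun c => ∑ t ∈ Finset.range K, ν c t with hn
  set a : γ → ℝ := fun c => 1 - ∑ t ∈ Finset.range K, ν c t * θ t with ha
  have hN : ∀ c, p * mc c + (s ^ 2 + 2) * h ≤ N c := fun c => Nat.le_ceil _
  have hN0 : ∀ c, 0 < N c := fun c => Nat.ceil_pos.2 (by positivity)
  have hnL : ∀ b, (L.filter fun i => β i = b).card = n (cls b) := card_fiber_large hq he hK hν
  have haL : ∀ b, 1 - a (cls b) ≤ ∑ i ∈ L.filter (fun i => β i = b), P.w i := fun b => by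
    rw [ha]
    simpa using le_weight_fiber_large hq he hK hν hθ1 b
  have hLO : ∀ b, L.filter (fun i => β i = b) ⊆ O.filter fun i => β i = b :=
    fun b => Finset.filter_subset_filter _ hL
  have hnk : ∀ c, n c ≤ P.k := fun c => by
    obtain ⟨b, rfl⟩ := hcls c
    rw [← hnL]
    exact ((hβ b).mono (hLO b)).1
  have ha0 : ∀ c, 0 ≤ a c := fun c => by
    obtain ⟨b, rfl⟩ := hcls c
    linarith [haL b, ((hβ b).mono (hLO b)).2]
  -- A small item exists only if `2 * s ^ 2 ≤ k`. Then large items weigh more than `1 / s ^ 2`, so a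
  -- bin holds at most `s ^ 2 ≤ k / 2` of them.
  have hnk2 : ∀ c, (U c).Nonempty → P.k ≤ 2 * (P.k - n c) := fun c ⟨i, hi⟩ => by
    have hk := (hsmall i (Finset.mem_filter.1 hi).1).2
    obtain ⟨b, rfl⟩ := hcls c
    have h4 : ((L.filter fun i => β i = b).card : ℝ) * (1 / s ^ 2) ≤ 1 := by
      rw [← nsmul_eq_mul]
      refine (Finset.card_nsmul_le_sum _ _ _ fun i hi => ?_).trans ((hβ b).mono (hLO b)).2
      exact (hlarge hk i (Finset.mem_filter.1 hi).1).le
    rw [mul_one_div, div_le_one hs2, hnL] at h4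
    have h5 : n (cls b) ≤ s ^ 2 := by exact_mod_cast h4
    omega
  have hmsum : ∑ c, mc c = P.m := by
    rw [← Finset.card_eq_sum_card_fiberwise fun b _ => Finset.mem_coe.2 (Finset.mem_univ _),
      Finset.card_univ, Fintype.card_fin]
  have hmcm : ∀ c, mc c ≤ P.m := fun c => by
    rw [← hmsum]
    exact Finset.single_le_sum (fun _ _ => Nat.zero_le _) (Finset.mem_univ c)
  have hNsum : ((∑ c, N c : ℕ) : ℝ) ≤ p * P.m + q := by
    calc ((∑ c, N c : ℕ) : ℝ) ≤ ∑ c, (p * mc c + ((s ^ 2 + 2) * h + 1)) := by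
          push_cast
          refine Finset.sum_le_sum fun c _ => ?_
          have := (Nat.ceil_lt_add_one (a := p * mc c + (s ^ 2 + 2) * h) (by positivity)).le
          linarith
      _ = p * P.m + Fintype.card γ * ((s ^ 2 + 2) * h + 1) := by
          rw [Finset.sum_add_distrib, ← Finset.mul_sum, ← hmsum, Nat.cast_sum, Finset.sum_const,
            Finset.card_univ, nsmul_eq_mul]
      _ ≤ p * P.m + q := by linarith
  have hUκ : ∀ c, (U c).card ≤ mc c * (P.k - n c) := fun c =>
    card_smallIn_le hL hβ fun b hb => by rw [hnL, hb]
  have hUa : ∀ c, ∑ i ∈ U c, P.w i ≤ mc c * a c := fun c =>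
    weight_smallIn_le hL hβ fun b hb => by rw [← hb]; exact haL b
  obtain ⟨φ, hφ1, hφ2⟩ := exists_slot_distribution hq he hK (Finset.inter_subset_right (s₁ := T))
    hν hp (by positivity) hTL (N := N) fun c =>
      (le_add_of_nonneg_right (by positivity)).trans (hN c)
  have hrem := fun c => exists_small_removal (Finset.inter_subset_right (s₁ := T)) (hd c)
    (by omega : 0 < s) hσ (((hUκ c).trans (Nat.mul_le_mul (hmcm c) (Nat.sub_le _ _))).trans hK')
    (ha0 c) hp hh.le (hUκ c) (hUa c) (hnk2 c) (hN c) (hTw c) (hTc c) (hTb c)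
  choose D hDT hDκ hDa hDc hDw using hrem
  set Q : γ → Finset I := fun c => (T ∩ L).filter fun i => e i / q ≠ 0 ∧ φ i = some c with hQ
  have hQL : ∀ c, ∀ i ∈ Q c, i ∈ L ∧ e i / q ≠ 0 ∧ φ i = some c := fun c i hi => by
    rw [hQ, Finset.mem_filter] at hi
    exact ⟨(Finset.mem_inter.1 hi.1).2, hi.2⟩
  have hpack : ∀ c, ∃ D' ⊆ (T ∩ U c) \ D c, D'.card ≤ N c ∧
      P.Packs (Q c ∪ (((T ∩ U c) \ D c) \ D')) (N c) := by
    intro c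
    refine exists_packs_class (K := K) (κ := P.k - n c) (g := fun i => e i / q - 1) (ν := ν c)
      (θ := θ) (a := a c) ?_ (hN0 c) ?_ hθ0 ?_ ?_ (hDκ c) (hDa c) ?_ ?_
    · refine Finset.disjoint_left.2 fun i hi hi' => ?_
      have h4 := (Finset.mem_inter.1 (Finset.mem_sdiff.1 hi').1).2
      exact (Finset.mem_sdiff.1 (Finset.mem_filter.1 h4).1).2 (hQL c i hi).1
    · intro i hi
      have h4 : e i / q < K := by
        rw [Nat.div_lt_iff_lt_mul hq]
        exact (he.lt (hQL c i hi).1).trans_le hK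
      exact (Nat.sub_le _ _).trans_lt h4
    · intro i hi
      exact hθ2 i (hQL c i hi).1 _
        (Nat.sub_add_cancel (Nat.one_le_iff_ne_zero.2 (hQL c i hi).2.1)).symm
    · intro t _
      refine le_trans (Finset.card_le_card fun i hi => ?_) (hφ1 c t)
      simp only [hQ, Finset.mem_filter] at hi ⊢
      refine ⟨hi.1.1, ?_, hi.1.2.2⟩
      rw [← hi.2, Nat.sub_add_cancel (Nat.one_le_iff_ne_zero.2 hi.1.2.1)]
    · have := hnk c
      change n c + (P.k - n c) ≤ P.k
      omega
    · simp [ha]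
  choose D' hD'T hD'c hpacks using hpack
  set Z : Finset I := Finset.univ.biUnion fun c => D c ∪ D' c with hZ
  have hZmem : ∀ c, D c ∪ D' c ⊆ U c := fun c => Finset.union_subset
    ((hDT c).trans Finset.inter_subset_right)
    (((hD'T c).trans Finset.sdiff_subset).trans Finset.inter_subset_right)
  have hZsmall : ∀ i ∈ Z, P.w i ≤ 1 / s ^ 2 ∧ 2 * s ^ 2 ≤ P.k := fun i hi => by
    obtain ⟨c, -, hc⟩ := Finset.mem_biUnion.1 hi
    exact hsmall i (Finset.mem_filter.1 (hZmem c hc)).1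
  have hmq : (P.m : ℝ) = q * s ^ 2 := by rw [hm]; push_cast; ring
  have hs4 : (4 : ℝ) ≤ (s : ℝ) ^ 2 := by
    have : (2 : ℝ) ≤ s := by exact_mod_cast hs
    nlinarith
  have hq0 : (0 : ℝ) < q := Nat.cast_pos.2 hq
  have hNm : p * P.m + q ≤ 2 * (q * s ^ 2) := by
    rw [hmq]
    nlinarith [mul_pos hq0 hs2]
  -- The removed small items number at most `5 * q * k` and weigh at most `(m + ∑ c, N c) / s ^ 2 ≤
  -- 3 * q`, which is below `5 * q * (3 / 4)`.
  have hZpacks : P.Packs Z (5 * q) := by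
    rcases Z.eq_empty_or_nonempty with h0 | ⟨i0, hi0⟩
    · rw [h0]
      exact packs_empty _
    have hk : (2 : ℝ) * s ^ 2 ≤ P.k := by exact_mod_cast (hZsmall i0 hi0).2
    refine packs_of_small (by omega) ?_ (fun i hi => (hZsmall i hi).1.trans ?_) ?_
    · have h4 : (Z.card : ℝ) ≤ 5 * q * P.k := by
        calc (Z.card : ℝ) ≤ ((∑ c, ((D c).card + (D' c).card) : ℕ) : ℝ) :=
              Nat.cast_le.2 (Finset.card_biUnion_le.trans
                (Finset.sum_le_sum fun c _ => Finset.card_union_le _ _))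
          _ ≤ ∑ c, ((σ + K' * (P.k * h + 1)) + (N c : ℝ)) := by
              push_cast
              exact Finset.sum_le_sum fun c _ => add_le_add (hDc c) (Nat.cast_le.2 (hD'c c))
          _ = Fintype.card γ * (σ + K' * (P.k * h + 1)) + (∑ c, N c : ℕ) := by
              rw [Finset.sum_add_distrib, Finset.sum_const, Finset.card_univ, nsmul_eq_mul,
                Nat.cast_sum]
          _ ≤ 3 * (P.k * q) + 2 * (q * s ^ 2) := add_le_add h3 (hNsum.trans hNm)
          _ ≤ 5 * q * P.k := by nlinarith
      exact_mod_cast h4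
    · exact one_div_le_one_div_of_le (by norm_num) hs4
    · calc ∑ i ∈ Z, P.w i ≤ ∑ c, ∑ i ∈ D c ∪ D' c, P.w i :=
            sum_biUnion_le_sum _ _ P.w_nonneg
        _ ≤ ∑ c, ((mc c : ℝ) / s ^ 2 + N c / s ^ 2) := by
            refine Finset.sum_le_sum fun c _ => ?_
            have h4 := Finset.sum_union_inter (s₁ := D c) (s₂ := D' c) (f := P.w)
            have h5 : 0 ≤ ∑ i ∈ D c ∩ D' c, P.w i := Finset.sum_nonneg fun i _ => P.w_nonneg i
            have h6 : ∑ i ∈ D' c, P.w i ≤ N c / s ^ 2 := by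
              calc ∑ i ∈ D' c, P.w i ≤ (D' c).card • (1 / (s : ℝ) ^ 2) :=
                    Finset.sum_le_card_nsmul _ _ _ fun i hi =>
                      (hsmall i (Finset.mem_filter.1
                        (hZmem c (Finset.mem_union_right _ hi))).1).1
                _ ≤ N c * (1 / (s : ℝ) ^ 2) := by
                    rw [nsmul_eq_mul]
                    have := hD'c c
                    gcongr
                _ = N c / s ^ 2 := by ring
            linarith [hDw c]
        _ = (P.m + (∑ c, N c : ℕ)) / s ^ 2 := by
            rw [← hmsum, Nat.cast_sum, Nat.cast_sum, ← Finset.sum_add_distrib, Finset.sum_div]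
            exact Finset.sum_congr rfl fun c _ => by ring
        _ ≤ (3 * (q * s ^ 2)) / s ^ 2 := by
            have := hNsum.trans hNm
            gcongr
            linarith
        _ = 3 * q := by field_simp
        _ ≤ ((5 * q : ℕ) : ℝ) * (3 / 4) := by push_cast; linarith
  set X : Finset I := (T ∩ L).filter fun i => e i / q ≠ 0 ∧ φ i = none with hX
  set T₀ : Finset I := (T ∩ L).filter fun i => e i / q = 0 with hT₀
  have hT₀c : T₀.card ≤ q := (Finset.card_le_card
    (Finset.filter_subset_filter _ Finset.inter_subset_right)).trans (he.card_block_le hq 0)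
  -- At most `q` bins for undistributed large items, `q` for the heaviest group, `p * m + q` for the
  -- classes and `5 * q` for removed small items.
  refine ⟨X.card + q + ∑ c, N c + 5 * q, ?_, ?_⟩
  · have h4 : (X.card : ℝ) ≤ q := hφ2.trans h2
    rw [Nat.cast_add, Nat.cast_add, Nat.cast_add, Nat.cast_mul]
    push_cast at hNsum ⊢
    linarith
  · refine (((packs_card X).union ((packs_card T₀).mono le_rfl hT₀c)).union
      (Packs.biUnion Finset.univ fun c _ => hpacks c)).union hZpacks |>.mono ?_ le_rfl
    intro i hi
    simp only [Finset.mem_union]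
    by_cases hiL : i ∈ L
    · have hiTL : i ∈ T ∩ L := Finset.mem_inter.2 ⟨hi, hiL⟩
      by_cases h0 : e i / q = 0
      · exact Or.inl (Or.inl (Or.inr (Finset.mem_filter.2 ⟨hiTL, h0⟩)))
      · rcases hφ : φ i with _ | c
        · exact Or.inl (Or.inl (Or.inl (Finset.mem_filter.2 ⟨hiTL, h0, hφ⟩)))
        · refine Or.inl (Or.inr (Finset.mem_biUnion.2 ⟨c, Finset.mem_univ _, ?_⟩))
          exact Finset.mem_union_left _ (Finset.mem_filter.2 ⟨hiTL, h0, hφ⟩)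
    · set c := cls (β i)
      have hiU : i ∈ T ∩ U c := Finset.mem_inter.2 ⟨hi, Finset.mem_filter.2
        ⟨Finset.mem_sdiff.2 ⟨hTO hi, hiL⟩, rfl⟩⟩
      by_cases hD1 : i ∈ D c ∪ D' c
      · exact Or.inr (Finset.mem_biUnion.2 ⟨c, Finset.mem_univ _, hD1⟩)
      · rw [Finset.mem_union, not_or] at hD1
        refine Or.inl (Or.inr (Finset.mem_biUnion.2 ⟨c, Finset.mem_univ _, ?_⟩))
        exact Finset.mem_union_right _ (Finset.mem_sdiff.2
          ⟨Finset.mem_sdiff.2 ⟨hiU, hD1.1⟩, hD1.2⟩)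

end Sampled

end CMK

/-! ### A bounded family of test functionals. -/

namespace CMK

variable {I : Type*} [Fintype I] [DecidableEq I] {P : CMK I}

theorem card_le_of_lt_weight {A : Finset I} {r : ℕ} (hr : 0 < r) (hA : ∑ i ∈ A, P.w i ≤ 1)
    (h : ∀ i ∈ A, 1 / (r : ℝ) < P.w i) : A.card ≤ r := by
  have h1 : (A.card : ℝ) * (1 / r) ≤ 1 := by
    rw [← nsmul_eq_mul]
    exact (Finset.card_nsmul_le_sum _ _ _ fun i hi => (h i hi).le).trans hA
  rw [mul_one_div, div_le_one (Nat.cast_pos.2 hr)] at h1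
  exact_mod_cast h1

theorem sum_indicator_le {C A : Finset I} {τ : ℝ} (h : ((C ∩ A).card : ℝ) ≤ τ) :
    ∑ i ∈ C, (if i ∈ A then (1 : ℝ) else 0) ≤ τ := by
  simpa using h

theorem inter_block (T A : Finset I) (e : I → ℕ) (s t : ℕ) :
    T ∩ IsRank.block A e s t = (T ∩ A).filter fun i => e i / s = t := by
  ext i
  simp only [IsRank.block, Finset.mem_inter, Finset.mem_filter, and_assoc]

/-- The numerical conditions of `exists_packs_of_sampled`. -/
theorem sampled_numerics {s q B g k m : ℕ} (hs : 0 < s) (hm : m = q * s ^ 2)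
    (hB : 8 * s ^ 8 ≤ B) (hBq : B ^ 4 ≤ q) (hg : g ≤ B) (hk : 0 < k) {h : ℝ}
    (hh : h = m / B ^ 3) :
    (g : ℝ) * ((s ^ 2 + 2) * h + 1) ≤ q ∧ ((2 * s ^ 4 : ℕ) : ℝ) * (2 * s ^ 2 * h) ≤ q ∧
      (g : ℝ) * ((m * k / (B * s ^ 2) + 1 : ℕ) + (B * s ^ 2 : ℕ) * (k * h + 1)) ≤ 3 * (k * q) := by
  have hs1 : (1 : ℝ) ≤ s := by exact_mod_cast hs
  have hs2 : (1 : ℝ) ≤ (s : ℝ) ^ 2 := one_le_pow₀ hs1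
  have hs4 : (s : ℝ) ^ 2 ≤ s ^ 4 := pow_le_pow_right₀ hs1 (by norm_num)
  have hs8 : (s : ℝ) ^ 4 ≤ s ^ 8 := pow_le_pow_right₀ hs1 (by norm_num)
  have hB' : 8 * (s : ℝ) ^ 8 ≤ B := by exact_mod_cast hB
  have hB8 : (8 : ℝ) ≤ B := by linarith
  have hB0 : (0 : ℝ) < B := by linarith
  have hBq' : (B : ℝ) ^ 4 ≤ q := by exact_mod_cast hBq
  have hg' : (g : ℝ) ≤ B := by exact_mod_cast hg
  have hk1 : (1 : ℝ) ≤ k := by exact_mod_cast hk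
  have hq0 : (0 : ℝ) ≤ q := Nat.cast_nonneg _
  have hm' : (m : ℝ) = q * s ^ 2 := by rw [hm]; push_cast; ring
  have hh' : h = q * s ^ 2 / B ^ 3 := by rw [hh, hm']
  have hh0 : 0 ≤ h := by rw [hh']; positivity
  have hsB : (s : ℝ) ^ 2 ≤ B := by linarith
  have hs4B : (s : ℝ) ^ 4 ≤ B := by linarith
  have hBh : B * (s ^ 4 * h) ≤ q / 8 := by
    rw [hh']
    have e : (B : ℝ) * (s ^ 4 * (q * s ^ 2 / B ^ 3)) = q * (s ^ 2 * s ^ 4 / B ^ 2) := by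
      field_simp
    have h1 : (s : ℝ) ^ 2 * s ^ 4 / B ^ 2 ≤ 1 / 8 := by
      rw [div_le_iff₀ (by positivity)]
      have h2 : (s : ℝ) ^ 2 * s ^ 4 ≤ s ^ 8 := by
        rw [← pow_add]
        exact pow_le_pow_right₀ hs1 (by norm_num)
      nlinarith
    rw [e]
    nlinarith
  have hB2 : (B : ℝ) + B ^ 2 * s ^ 2 ≤ q / 4 := by
    have h1 : (B : ℝ) ^ 2 * s ^ 2 ≤ B ^ 3 := by
      calc (B : ℝ) ^ 2 * (s : ℝ) ^ 2 ≤ (B : ℝ) ^ 2 * B := by gcongr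
        _ = (B : ℝ) ^ 3 := by ring
    have h2 : (B : ℝ) ≤ B ^ 3 := le_self_pow₀ (by linarith) (by norm_num)
    have h3 : 8 * (B : ℝ) ^ 3 ≤ B ^ 4 := by
      calc 8 * (B : ℝ) ^ 3 ≤ (B : ℝ) * (B : ℝ) ^ 3 := by gcongr
        _ = (B : ℝ) ^ 4 := by ring
    linarith
  have hB3 : (B : ℝ) ≤ q / 4 := by
    have : 0 ≤ (B : ℝ) ^ 2 * s ^ 2 := by positivity
    linarith
  refine ⟨?_, ?_, ?_⟩
  · calc (g : ℝ) * ((s ^ 2 + 2) * h + 1) ≤ B * (3 * s ^ 4 * h + 1) := by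
          gcongr
          linarith
      _ = 3 * (B * (s ^ 4 * h)) + B := by ring
      _ ≤ q := by linarith
  · push_cast
    calc 2 * (s : ℝ) ^ 4 * (2 * s ^ 2 * h) = 4 * (s ^ 2 * (s ^ 4 * h)) := by ring
      _ ≤ 4 * (B * (s ^ 4 * h)) := by gcongr
      _ ≤ q := by linarith
  · have h1 : ((m * k / (B * s ^ 2) + 1 : ℕ) : ℝ) ≤ q * k / B + 1 := by
      push_cast
      refine add_le_add_left (Nat.cast_div_le.trans_eq ?_) 1
      push_cast
      rw [hm']
      field_simp
    have h2 : (B : ℝ) * s ^ 2 * (k * h) ≤ q * k / B := by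
      have e : (B : ℝ) * s ^ 2 * (k * h) = (q * k / B) * (s ^ 4 / B) := by
        rw [hh']
        field_simp
      rw [e]
      refine mul_le_of_le_one_right (by positivity) ((div_le_one hB0).2 hs4B)
    calc (g : ℝ) * ((m * k / (B * s ^ 2) + 1 : ℕ) + (B * s ^ 2 : ℕ) * (k * h + 1))
        ≤ B * ((q * k / B + 1) + (q * k / B + B * s ^ 2)) := by
          have : ((B * s ^ 2 : ℕ) : ℝ) * (k * h + 1) ≤ q * k / B + B * s ^ 2 := by
            push_cast
            linarith
          gcongr
      _ = 2 * (k * q) + (B + B ^ 2 * s ^ 2) := by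
          field_simp
          ring
      _ ≤ 3 * (k * q) := by nlinarith

open Classical in
/-- There is a bounded number of bounded linear functionals such that every set of items of a
solution on which none of them exceeds its expectation by much fits into few bins. -/
theorem exists_test_functionals {s q B : ℕ} (hs : 2 ≤ s) (hq : 0 < q) (hm : P.m = q * s ^ 2)
    (hB : 8 * s ^ 8 ≤ B) (hBq : B ^ 4 ≤ q) (hBs : (2 * s ^ 2 + 1) ^ (2 * s ^ 4) ≤ B)
    {O : Finset I} {β : I → Fin P.m} (hβ : ∀ b, P.IsConfig (O.filter fun i => β i = b)) :
    ∃ (F : Type) (_ : Fintype F) (u : F → I → ℝ) (τ : F → ℝ), Fintype.card F ≤ B ^ 3 ∧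
      (∀ f, 0 < τ f) ∧ (∀ f i, 0 ≤ u f i) ∧ (∀ f, ∀ i ∉ O, u f i = 0) ∧
      (∀ f, ∀ C : P.Config, ∑ i ∈ C.1, u f i ≤ τ f) ∧
      ∀ p : ℝ, 0 ≤ p → p ≤ 1 → ∀ T ⊆ O,
        (∀ f, ∑ i ∈ T, u f i ≤ p * ∑ i, u f i + τ f * (P.m / B ^ 3)) →
        ∃ n : ℕ, (n : ℝ) ≤ p * P.m + 8 * q ∧ P.Packs T n := by
  have hs0 : 0 < s := by omega
  have hB0 : 0 < B := lt_of_lt_of_le (by positivity) hB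
  have hk0 : (0 : ℝ) < P.k := Nat.cast_pos.2 P.k_pos
  -- When `k < 2 * s ^ 2` every item counts as large. In both cases a configuration has at most `2 *
  -- s ^ 2` large items.
  set L := O.filter fun i => 1 / (s : ℝ) ^ 2 < P.w i ∨ P.k < 2 * s ^ 2 with hLdef
  have hL : L ⊆ O := Finset.filter_subset _ _
  have hsmall : ∀ i ∈ O \ L, P.w i ≤ 1 / s ^ 2 ∧ 2 * s ^ 2 ≤ P.k := by
    intro i hi
    rw [Finset.mem_sdiff, hLdef, Finset.mem_filter] at hi
    exact ⟨not_lt.1 fun h => hi.2 ⟨hi.1, Or.inl h⟩, not_lt.1 fun h => hi.2 ⟨hi.1, Or.inr h⟩⟩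
  have hlarge : 2 * s ^ 2 ≤ P.k → ∀ i ∈ L, 1 / (s : ℝ) ^ 2 < P.w i := fun hk i hi =>
    (Finset.mem_filter.1 hi).2.resolve_right hk.not_gt
  have hLC : ∀ C : Finset I, P.IsConfig C → (C ∩ L).card ≤ 2 * s ^ 2 := by
    intro C hC
    have hCL := hC.mono (Finset.inter_subset_left (s₂ := L))
    by_cases hk : 2 * s ^ 2 ≤ P.k
    · refine (card_le_of_lt_weight (r := s ^ 2) (by positivity) hCL.2 fun i hi => ?_).trans
        (by omega)
      push_cast
      exact hlarge hk i (Finset.mem_inter.1 hi).2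
    · exact hCL.1.trans (by omega)
  have hLb : ∀ b, (L.filter fun i => β i = b).card ≤ 2 * s ^ 2 := fun b => by
    refine (Finset.card_le_card fun i hi => ?_).trans (hLC _ (hβ b))
    rw [Finset.mem_filter] at hi
    exact Finset.mem_inter.2 ⟨Finset.mem_filter.2 ⟨hL hi.1, hi.2⟩, hi.1⟩
  obtain ⟨e, he⟩ := exists_isRank L P.w
  set K := 2 * s ^ 4 with hKdef
  have hK : L.card ≤ K * q := by
    have h1 := Finset.card_le_mul_card_image_of_maps_to (f := β) (s := L) (t := Finset.univ)
      (fun i _ => Finset.mem_univ _) _ fun b _ => hLb b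
    rw [Finset.card_univ, Fintype.card_fin, hm] at h1
    refine h1.trans_eq ?_
    rw [hKdef]
    ring
  let cls₀ : Fin P.m → Fin K → Fin (2 * s ^ 2 + 1) := fun b t =>
    ⟨(L.filter fun i => β i = b ∧ e i / q = t).card, Nat.lt_succ_of_le
      ((Finset.card_le_card (Finset.monotone_filter_right _ fun i _ h => h.1)).trans (hLb b))⟩
  -- Restricting to classes that occur gives each a representative bin, which shows that its slots
  -- leave nonnegative room.
  let cls : Fin P.m → Set.range cls₀ := Set.rangeFactorization cls₀
  have hcls : Function.Surjective cls := Set.rangeFactorization_surjective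
  let ν : Set.range cls₀ → ℕ → ℕ := fun c t => if h : t < K then (c.1 ⟨t, h⟩).val else 0
  have hν : ∀ b t, (L.filter fun i => β i = b ∧ e i / q = t).card = ν (cls b) t := by
    intro b t
    by_cases ht : t < K
    · simp only [ν, dif_pos ht]
      rfl
    · simp only [ν, dif_neg ht]
      rw [Finset.card_eq_zero, Finset.filter_eq_empty_iff]
      rintro i hi ⟨-, hit⟩
      rw [← hit, Nat.div_lt_iff_lt_mul hq] at ht
      exact ht ((he.lt hi).trans_le hK)
  have hγ : Fintype.card (Set.range cls₀) ≤ B := by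
    refine (Fintype.card_le_of_injective _ Subtype.val_injective).trans ?_
    rw [Fintype.card_fun, Fintype.card_fin, Fintype.card_fin]
    exact hBs
  set U : Set.range cls₀ → Finset I := smallIn O L β cls with hU
  have hUO : ∀ c, U c ⊆ O := fun c => (Finset.filter_subset _ _).trans Finset.sdiff_subset
  choose d hd using fun c => exists_isRank (U c) P.w
  set K' := B * s ^ 2 with hK'def
  have hK'0 : 0 < K' := by positivity
  set σ := P.m * P.k / K' + 1 with hσ
  have hσK : P.m * P.k ≤ K' * σ := (Nat.lt_mul_div_succ _ hK'0).le
  obtain ⟨h1, h2, h3⟩ := sampled_numerics (g := Fintype.card (Set.range cls₀)) hs0 hm hB hBq hγ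
    P.k_pos rfl
  have hh : (0 : ℝ) < P.m / B ^ 3 := by
    have : (0 : ℝ) < P.m := Nat.cast_pos.2 P.m_pos
    positivity
  -- Counted are the large items per group, the small items per class, and the small items per
  -- sorted block of a class. The functionals in `F` add the weight of the small items of each
  -- class.
  let A : Fin K ⊕ Set.range cls₀ ⊕ Set.range cls₀ × Fin K' → Finset I := fun f => match f with
    | .inl t => IsRank.block L e q t
    | .inr (.inl c) => U c
    | .inr (.inr c) => IsRank.block (U c.1) (d c.1) σ c.2
  let F := (Fin K ⊕ Set.range cls₀ ⊕ Set.range cls₀ × Fin K') ⊕ Set.range cls₀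
  let u : F → I → ℝ := fun f i => match f with
    | .inl f => if i ∈ A f then 1 else 0
    | .inr c => if i ∈ U c then P.w i else 0
  let τ : F → ℝ := fun f => match f with
    | .inl (.inl _) => 2 * s ^ 2
    | .inl (.inr _) => P.k
    | .inr _ => 1
  have hAO : ∀ f, A f ⊆ O := by
    rintro (t | c | c)
    · exact (Finset.filter_subset _ _).trans hL
    · exact hUO c
    · exact (Finset.filter_subset _ _).trans (hUO c.1)
  refine ⟨F, inferInstance, u, τ, ?_, ?_, ?_, ?_, ?_, ?_⟩
  · simp only [F, Fintype.card_sum, Fintype.card_prod, Fintype.card_fin]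
    set g := Fintype.card (Set.range cls₀)
    have hs8 : s ^ 4 ≤ s ^ 8 := Nat.pow_le_pow_right hs0 (by norm_num)
    have hs2 : s ^ 2 ≤ s ^ 8 := Nat.pow_le_pow_right hs0 (by norm_num)
    have hs1 : 1 ≤ s ^ 8 := Nat.one_le_pow _ _ hs0
    have e1 : 4 * s ^ 2 ≤ B := by omega
    have e2 : K ≤ B := by omega
    calc K + (g + g * K') + g ≤ B + (B + B * K') + B := by gcongr
      _ = 3 * B + B ^ 2 * s ^ 2 := by rw [hK'def]; ring
      _ ≤ B ^ 3 := by
          have e3 : B ^ 2 * (4 * s ^ 2) ≤ B ^ 2 * B := Nat.mul_le_mul_left _ e1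
          have e4 : 8 * (8 * B) ≤ B ^ 3 := by
            have : 8 ≤ B := by omega
            calc 8 * (8 * B) ≤ B * (B * B) := by gcongr
              _ = B ^ 3 := by ring
          nlinarith
  · rintro ((t | c) | c)
    · simp only [τ]
      positivity
    · exact hk0
    · exact one_pos
  · rintro (f | c) i
    · simp only [u]
      split_ifs <;> norm_num
    · simp only [u]
      split_ifs
      · exact P.w_nonneg i
      · exact le_rfl
  · rintro (f | c) i hi
    · exact if_neg fun h => hi (hAO f h)
    · exact if_neg fun h => hi (hUO c h)
  · have hk : ∀ (C : P.Config) (A : Finset I), ((C.1 ∩ A).card : ℝ) ≤ P.k := fun C A =>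
      Nat.cast_le.2 ((Finset.card_le_card Finset.inter_subset_left).trans C.2.1)
    rintro ((t | c) | c) C
    · refine sum_indicator_le ?_
      have : (C.1 ∩ IsRank.block L e q t).card ≤ 2 * s ^ 2 :=
        (Finset.card_le_card (Finset.inter_subset_inter_left (Finset.filter_subset _ _))).trans
          (hLC C.1 C.2)
      change ((C.1 ∩ IsRank.block L e q t).card : ℝ) ≤ 2 * (s : ℝ) ^ 2
      exact_mod_cast this
    · exact sum_indicator_le (hk C _)
    · refine le_trans (Finset.sum_le_sum fun i _ => ?_) C.2.2
      simp only [u]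
      split_ifs
      · exact le_rfl
      · exact P.w_nonneg i
  · intro p hp hp1 T hTO hT
    have hcard : ∀ f, ((T ∩ A f).card : ℝ) ≤ p * (A f).card + τ (.inl f) * (P.m / B ^ 3) :=
      fun f => by simpa [u] using hT (.inl f)
    refine exists_packs_of_sampled hs hq hm hβ hL hsmall hlarge he hK hcls hν hd
      (Nat.succ_pos _) hσK hp hp1 hh hTO ?_ ?_ ?_ ?_ h1 h2 h3
    · intro t ht
      rw [← inter_block]
      exact hcard (.inl ⟨t, ht⟩)
    · intro c
      simpa [u, τ] using hT (.inr c)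
    · intro c
      exact hcard (.inr (.inl c))
    · intro c t ht
      rw [← inter_block]
      exact hcard (.inr (.inr (c, ⟨t, ht⟩)))

end CMK

/-! ### The value of the linear program -/

namespace CMK

variable {I : Type*} [Fintype I] [DecidableEq I] {P : CMK I}

theorem setValue_nonneg (T : Finset I) : 0 ≤ P.setValue T :=
  Finset.sum_nonneg fun i _ => P.v_nonneg i

theorem setValue_mono {T T' : Finset I} (h : T ⊆ T') : P.setValue T ≤ P.setValue T' :=
  Finset.sum_le_sum_of_subset_of_nonneg h fun i _ _ => P.v_nonneg i

theorem fracValue_nonneg (x : P.FracSol) : 0 ≤ P.fracValue x :=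
  Finset.sum_nonneg fun i _ => mul_nonneg (cover_nonneg x i) (P.v_nonneg i)

/-- A packing of `T` into `n` bins yields a fractional solution of smaller size after scaling. -/
theorem Packs.exists_feasible {T S : Finset I} {n : ℕ} (h : P.Packs T n) (hTS : T ⊆ S) {l c : ℝ}
    (hc : 0 ≤ c) (hc1 : c ≤ 1) (hl : c * n ≤ l) :
    ∃ y : P.FracSol, P.LPFeasible S l y ∧ P.fracValue y = c * P.setValue T := by
  classical
  obtain ⟨f, hf, hcfg⟩ := h
  let bin : ℕ → P.Config := fun b => ⟨T.filter fun i => f i = b, hcfg b⟩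
  -- Each bin gets weight `c`; the empty configuration fills up to size exactly `l`.
  let y₀ : P.Config → ℝ := fun C =>
    (∑ b ∈ Finset.range n, if bin b = C then c else 0) + if P.emptyConfig = C then l - c * n else 0
  have hy₀ : ∀ C, 0 ≤ y₀ C := fun C => by
    refine add_nonneg (Finset.sum_nonneg fun b _ => ?_) ?_
    · split_ifs <;> simp [hc]
    · split_ifs
      · exact sub_nonneg.2 hl
      · exact le_rfl
  have hsum : ∀ g : P.Config → ℝ, ∑ C, y₀ C * g C
      = ∑ b ∈ Finset.range n, c * g (bin b) + (l - c * n) * g P.emptyConfig := by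
    intro g
    simp only [y₀, add_mul, Finset.sum_add_distrib, Finset.sum_mul, ite_mul, zero_mul]
    rw [Finset.sum_comm]
    simp
  obtain ⟨y, hy⟩ : ∃ y : P.FracSol, ∀ C, (y C : ℝ) = y₀ C :=
    ⟨fun C => (y₀ C).toNNReal, fun C => Real.coe_toNNReal _ (hy₀ C)⟩
  refine ⟨y, ?_⟩
  have hcover : ∀ i, P.cover y i = if i ∈ T then c else 0 := by
    intro i
    rw [cover_eq_sum]
    simp only [hy]
    rw [hsum]
    simp only [bin, emptyConfig, Finset.mem_filter, Finset.notMem_empty, if_false, mul_zero,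
      add_zero]
    split_ifs with hi
    · rw [Finset.sum_eq_single (f i)]
      · simp [hi]
      · intro b _ hb
        rw [if_neg fun h => hb h.2.symm, mul_zero]
      · intro hni
        exact absurd (Finset.mem_range.2 (hf i hi)) hni
    · exact Finset.sum_eq_zero fun b _ => by rw [if_neg fun h => hi h.1, mul_zero]
  refine ⟨⟨fun i => ?_, fun C hC => ?_, ?_⟩, ?_⟩
  · rw [hcover]
    split_ifs
    · exact hc1
    · exact zero_le_one
  · by_contra hCS
    refine hC (NNReal.eq ?_)
    rw [hy, NNReal.coe_zero]
    have h1 : ∀ b, bin b ≠ C := fun b hb =>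
      hCS (hb ▸ (Finset.filter_subset _ _).trans hTS)
    have h2 : P.emptyConfig ≠ C := fun hb => hCS (hb ▸ Finset.empty_subset _)
    simp [y₀, h1, h2]
  · have := hsum fun _ => 1
    simp only [mul_one, Finset.sum_const, Finset.card_range, nsmul_eq_mul] at this
    rw [size]
    simp only [hy]
    rw [this]
    ring
  · rw [fracValue]
    simp only [hcover, ite_mul, zero_mul]
    rw [Finset.sum_ite_mem, Finset.univ_inter, setValue, Finset.mul_sum]

/-- An item is sampled almost as often as the linear program covers it. -/
theorem le_one_sub_missProb {x : P.FracSol} (hx : 0 < P.size x) {i : I} (hc : P.cover x i ≤ 1)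
    (q : ℕ) :
    q / P.size x * (1 - q / P.size x) * P.cover x i ≤ 1 - missProb x q i := by
  set t := P.cover x i / P.size x with ht
  have ht0 : 0 ≤ t := div_nonneg (cover_nonneg x i) hx.le
  have ht1 : t ≤ 1 := (div_le_one hx).2 (cover_le_size x i)
  have hq0 : (0 : ℝ) ≤ q := Nat.cast_nonneg q
  have h1 : (1 - t) ^ q * (1 + t) ^ q ≤ 1 := by
    rw [← mul_pow]
    exact pow_le_one₀ (by nlinarith) (by nlinarith)
  have h2 : 1 + q * t ≤ (1 + t) ^ q := one_add_mul_le_pow (by linarith) q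
  have h3 : 0 ≤ (1 - t) ^ q := pow_nonneg (by linarith) q
  have h4 : (1 - t) ^ q * (1 + q * t) ≤ 1 := (mul_le_mul_of_nonneg_left h2 h3).trans h1
  have hqt : 0 ≤ q * t := mul_nonneg hq0 ht0
  -- From `(1 - t) ^ q ≤ 1 / (1 + y)` with `y = q * t`, and `(1 - y + y ^ 2) * (1 + y) = 1 + y ^ 3 ≥
  -- 1`.
  have h5 : q * t * (1 - q * t) ≤ 1 - (1 - t) ^ q := by
    by_contra hlt
    push Not at hlt
    have h6 : (1 - q * t + (q * t) ^ 2) * (1 + q * t) < (1 - t) ^ q * (1 + q * t) :=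
      mul_lt_mul_of_pos_right (by linarith) (by linarith)
    nlinarith [pow_nonneg hqt 3]
  have h7 : t ≤ 1 / P.size x := div_le_div_of_nonneg_right hc hx.le
  have h8 : q * t ≤ q / P.size x := by
    calc q * t ≤ q * (1 / P.size x) := mul_le_mul_of_nonneg_left h7 hq0
      _ = q / P.size x := by ring
  calc q / P.size x * (1 - q / P.size x) * P.cover x i = q * t * (1 - q / P.size x) := by
        rw [ht]; ring
    _ ≤ q * t * (1 - q * t) := mul_le_mul_of_nonneg_left (by linarith) hqt
    _ ≤ 1 - missProb x q i := h5

theorem cover_eq_zero {S : Finset I} {l : ℝ} {x : P.FracSol} (hx : P.LPFeasible S l x) {i : I}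
    (hi : i ∉ S) : P.cover x i = 0 := by
  refine Finset.sum_eq_zero fun C hC => ?_
  by_contra h
  exact hi (hx.2.1 C (fun h0 => h (by rw [h0, NNReal.coe_zero])) (Finset.mem_filter.1 hC).2)

/-- The expected gain of one iteration in terms of the value of the linear program. -/
theorem expect_setValue_packed_succ {q j : ℕ} (X : P.LPRule q) {l : ℝ} (hl : 0 < l)
    (hX : ∀ h : P.History q j, P.LPFeasible (P.remaining h) l (X j h)) :
    (P.run X j).expect (fun h => P.setValue (P.packed h))
        + q / l * (1 - q / l) * (P.run X j).expect (fun h => P.fracValue (X j h))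
      ≤ (P.run X (j + 1)).expect fun h => P.setValue (P.packed h) := by
  rw [expect_run_succ, ← PMF.expect_const_mul, ← PMF.expect_add]
  refine PMF.expect_mono _ fun h => ?_
  have hsize := (hX h).2.2
  have hl' : 0 < P.size (X j h) := hsize ▸ hl
  have hval : ∀ r : Fin q → P.Config, P.setValue (P.packed h ∪ hit r)
      = P.setValue (P.packed h) + ∑ i ∈ P.remaining h, P.v i * (1 - missed r i) := by
    intro r
    rw [← Finset.union_sdiff_self_eq_union, setValue, Finset.sum_union Finset.disjoint_sdiff]
    refine congrArg₂ _ rfl ?_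
    have e : hit r \ P.packed h = (P.remaining h).filter fun i => i ∈ hit r := by
      ext i
      simp [remaining, and_comm]
    rw [e, Finset.sum_filter]
    exact Finset.sum_congr rfl fun i _ => by rw [missed]; split_ifs <;> simp
  simp only [packed_snoc, hval]
  rw [PMF.expect_add, PMF.expect_const, PMF.expect_sum]
  refine add_le_add_right ?_ _
  have hfrac : P.fracValue (X j h) = ∑ i ∈ P.remaining h, P.cover (X j h) i * P.v i := by
    refine (Finset.sum_subset (Finset.subset_univ _) fun i _ hi => ?_).symm
    rw [cover_eq_zero (hX h) hi, zero_mul]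
  rw [hfrac, Finset.mul_sum]
  refine Finset.sum_le_sum fun i _ => ?_
  rw [PMF.expect_const_mul, PMF.expect_sub, PMF.expect_const, expect_missed hl']
  have h1 := le_one_sub_missProb hl' ((hX h).1 i) q
  rw [hsize, missProb, hsize] at h1
  rw [hsize]
  calc _ = P.v i * (q / l * (1 - q / l) * P.cover (X j h) i) := by ring
    _ ≤ _ := mul_le_mul_of_nonneg_left h1 (P.v_nonneg i)

theorem expect_setValue_packed_mono {q j : ℕ} (X : P.LPRule q) :
    (P.run X j).expect (fun h => P.setValue (P.packed h))
      ≤ (P.run X (j + 1)).expect fun h => P.setValue (P.packed h) := by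
  rw [expect_run_succ]
  refine PMF.expect_mono _ fun h => ?_
  rw [← PMF.expect_const (iidLaw (P.configLaw (X j h)) q) (P.setValue (P.packed h))]
  refine PMF.expect_mono _ fun r => ?_
  rw [packed_snoc]
  exact setValue_mono Finset.subset_union_left

/-- An optimal solution can be assumed to assign every item to one bin. -/
theorem exists_optimal_assignment (P : CMK I) : ∃ (O : Finset I) (β : I → Fin P.m),
    (∀ b, P.IsConfig (O.filter fun i => β i = b)) ∧ P.setValue O = P.opt := by
  obtain ⟨C, hC⟩ := P.opt_isGreatest.1
  have key : ∀ i, ∃ b : Fin P.m, i ∈ Finset.univ.biUnion (fun b => (C b).1) → i ∈ (C b).1 := by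
    intro i
    by_cases hi : i ∈ Finset.univ.biUnion fun b => (C b).1
    · obtain ⟨b, -, hb⟩ := Finset.mem_biUnion.1 hi
      exact ⟨b, fun _ => hb⟩
    · exact ⟨⟨0, P.m_pos⟩, fun h => absurd h hi⟩
  choose β hβ using key
  refine ⟨_, β, fun b => IsConfig.mono (C b).2 fun i hi => ?_, hC⟩
  rw [Finset.mem_filter] at hi
  rw [← hi.2]
  exact hβ i hi.1

/-- The functional lives on `O`, which splits into `m` configurations. -/
theorem sum_le_of_assignment {O : Finset I} {β : I → Fin P.m}
    (hβ : ∀ b, P.IsConfig (O.filter fun i => β i = b)) {u : I → ℝ} (hu : ∀ i ∉ O, u i = 0) {τ : ℝ}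
    (hτ : ∀ C : P.Config, ∑ i ∈ C.1, u i ≤ τ) : ∑ i, u i ≤ P.m * τ := by
  rw [← Finset.sum_subset (Finset.subset_univ O) fun i _ hi => hu i hi,
    ← Finset.sum_fiberwise_of_maps_to (g := β) (t := Finset.univ) fun i _ => Finset.mem_univ _]
  refine (Finset.sum_le_card_nsmul _ _ _ fun b _ => hτ ⟨_, hβ b⟩).trans_eq ?_
  rw [Finset.card_univ, Fintype.card_fin, nsmul_eq_mul]

/-- After `j` iterations, the linear program retains almost a fraction `1 - j * ε` of the value of
an optimal solution. -/
theorem le_expect_fracValue {s q B N j : ℕ} (hs : 2 ≤ s) (hq : 0 < q) (hm : P.m = q * s ^ 2)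
    (hB : 8 * s ^ 8 ≤ B) (hBq : B ^ 10 ≤ q) (hBs : (2 * s ^ 2 + 1) ^ (2 * s ^ 4) ≤ B) {ε p : ℝ}
    (hε : ε = 1 / s ^ 2) {X : P.LPRule q} (hX : X.IsApprox ε N) (hjN : j < N)
    (hp : p = 1 - j * ε) (hp0 : 0 < p) :
    (1 - ε) * (p / (p + 8 * ε)) * (p - ε) * P.opt
      ≤ (P.run X j).expect fun h => P.fracValue (X j h) := by
  have hs0 : 0 < s := by omega
  have hs2 : (1 : ℝ) ≤ (s : ℝ) ^ 2 := one_le_pow₀ (by exact_mod_cast hs0)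
  have hε0 : 0 < ε := by rw [hε]; positivity
  have hε1 : ε ≤ 1 := by rw [hε]; exact (div_le_one (by positivity)).2 hs2
  have hqm : ε * P.m = q := by
    rw [hε, hm]
    push_cast
    field_simp
  have hm0 : (0 : ℝ) < P.m := Nat.cast_pos.2 P.m_pos
  have hB8 : 8 ≤ B := by
    have : 1 ≤ s ^ 8 := Nat.one_le_pow _ _ hs0
    omega
  have hB0 : (0 : ℝ) < B := Nat.cast_pos.2 (by omega)
  have hp1 : p ≤ 1 := by
    rw [hp]
    exact sub_le_self _ (by positivity)
  obtain ⟨O, β, hβ, hO⟩ := P.exists_optimal_assignment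
  obtain ⟨F, _, u, τ, hF, hτ0, hu0, huO, huτ, hpack⟩ := exists_test_functionals hs hq hm hB
    ((Nat.pow_le_pow_right (by omega) (by norm_num)).trans hBq) hBs hβ
  obtain ⟨κ, hκ0, hκ1, hκS, hκE, hκV⟩ := exists_survivor_law (P := P) hε0 hqm hX hjN.le
    (by linarith)
  rw [← hp] at hκE hκV
  -- This scaling brings `p * m + 8 * q = (p + 8 * ε) * m` bins down to the permitted size `p * m`.
  set c : ℝ := p / (p + 8 * ε) with hc
  have hpε : 0 < p + 8 * ε := by positivity
  have hc0 : 0 ≤ c := by positivity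
  have hc1 : c ≤ 1 := (div_le_one hpε).2 (by linarith)
  set d : F → ℝ := fun f => τ f * (P.m / B ^ 3) with hd
  have hd0 : ∀ f, 0 < d f := fun f => mul_pos (hτ0 f) (by positivity)
  -- Chebyshev's inequality without events: `bad T` is at least `1` as soon as one functional
  -- exceeds its tolerance, and then the lower bound in `hlp` is trivial because its left side is
  -- nonpositive.
  set bad : Finset I → ℝ := fun T =>
    ∑ f, (1 / d f ^ 2) * (∑ i ∈ T, u f i - p * ∑ i, u f i) ^ 2 with hbad
  have hbad0 : ∀ T, 0 ≤ bad T := fun T => Finset.sum_nonneg fun f _ => by positivity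
  have hlp : ∀ h T, T ⊆ P.remaining h →
      (1 - ε) * c * (P.setValue (T ∩ O) * (1 - bad T)) ≤ P.fracValue (X j h) := by
    intro h T hT
    have hcε : 0 ≤ (1 - ε) * c := mul_nonneg (by linarith) hc0
    have hv := setValue_nonneg (P := P) (T ∩ O)
    by_cases hgood : ∀ f, ∑ i ∈ T, u f i - p * ∑ i, u f i ≤ d f
    · have hsum : ∀ f, ∑ i ∈ T ∩ O, u f i = ∑ i ∈ T, u f i := fun f =>
        Finset.sum_subset Finset.inter_subset_left fun i hi hiO =>
          huO f i fun h => hiO (Finset.mem_inter.2 ⟨hi, h⟩)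
      obtain ⟨n, hn, hnp⟩ := hpack p hp0.le hp1 (T ∩ O) Finset.inter_subset_right fun f => by
        rw [hsum]
        linarith [hgood f]
      obtain ⟨y, hy, hyv⟩ := hnp.exists_feasible (S := P.remaining h) (l := P.m * (1 - j * ε))
        (Finset.inter_subset_left.trans hT) hc0 hc1 (by
          rw [← hp]
          calc c * n ≤ c * (p * P.m + 8 * q) := mul_le_mul_of_nonneg_left hn hc0
            _ = c * (p + 8 * ε) * P.m := by rw [← hqm]; ring
            _ = P.m * p := by rw [hc, div_mul_cancel₀ _ hpε.ne', mul_comm])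
      refine le_trans ?_ ((hX j hjN h).2 y hy)
      rw [hyv, ← mul_assoc (1 - ε)]
      refine mul_le_mul_of_nonneg_left ?_ hcε
      exact mul_le_of_le_one_right hv (by linarith [hbad0 T])
    · push Not at hgood
      obtain ⟨f, hf⟩ := hgood
      have h1 : 1 ≤ bad T := by
        refine le_trans ?_ (Finset.single_le_sum (f := fun f =>
          (1 / d f ^ 2) * (∑ i ∈ T, u f i - p * ∑ i, u f i) ^ 2)
          (fun f _ => by positivity) (Finset.mem_univ f))
        have hdf := hd0 f
        rw [one_div, inv_mul_eq_div, one_le_div (by positivity)]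
        exact pow_le_pow_left₀ hdf.le hf.le 2
      refine le_trans (mul_nonpos_of_nonneg_of_nonpos hcε ?_) (fracValue_nonneg _)
      exact mul_nonpos_of_nonneg_of_nonpos hv (by linarith)
  have hh : ∀ h, (1 - ε) * c * (∑ T, κ h T * P.setValue (T ∩ O)
      - P.opt * ∑ T, κ h T * bad T) ≤ P.fracValue (X j h) := by
    intro h
    calc (1 - ε) * c * (∑ T, κ h T * P.setValue (T ∩ O) - P.opt * ∑ T, κ h T * bad T)
        = ∑ T, κ h T * ((1 - ε) * c * (P.setValue (T ∩ O) - P.opt * bad T)) := by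
          simp only [Finset.mul_sum, mul_sub, ← Finset.sum_sub_distrib]
          exact Finset.sum_congr rfl fun T _ => by ring
      _ ≤ ∑ T, κ h T * P.fracValue (X j h) := by
          refine Finset.sum_le_sum fun T _ => ?_
          by_cases hT : κ h T = 0
          · rw [hT, zero_mul, zero_mul]
          · refine mul_le_mul_of_nonneg_left (le_trans ?_ (hlp h T (hκS h T hT))) (hκ0 h T)
            refine mul_le_mul_of_nonneg_left ?_ (mul_nonneg (by linarith) hc0)
            -- Bounding the value by `OPT` decouples it from `bad T`, so no joint moment is needed.
            have h1 : P.setValue (T ∩ O) ≤ P.opt := hO ▸ setValue_mono Finset.inter_subset_right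
            have h2 := mul_le_mul_of_nonneg_right h1 (hbad0 T)
            linarith
      _ = P.fracValue (X j h) := by rw [← Finset.sum_mul, hκ1, one_mul]
  have hEv : (P.run X j).expect (fun h => ∑ T, κ h T * P.setValue (T ∩ O)) = p * P.opt := by
    have h1 := hκE fun i => if i ∈ O then P.v i else 0
    simp only [Finset.sum_ite_mem, Finset.univ_inter] at h1
    rw [← hO]
    exact h1
  have hEbad : (P.run X j).expect (fun h => ∑ T, κ h T * bad T) ≤ ε := by
    have e : ∀ h, ∑ T, κ h T * bad T = ∑ f, (1 / d f ^ 2) *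
        ∑ T, κ h T * (∑ i ∈ T, u f i - p * ∑ i, u f i) ^ 2 := by
      intro h
      simp only [hbad, Finset.mul_sum]
      rw [Finset.sum_comm]
      exact Finset.sum_congr rfl fun f _ => Finset.sum_congr rfl fun T _ => by ring
    simp only [e]
    rw [PMF.expect_sum]
    simp only [PMF.expect_const_mul]
    calc _ ≤ ∑ f, (1 / d f ^ 2) * (2 * (P.m * τ f ^ 2)) := by
          refine Finset.sum_le_sum fun f _ => mul_le_mul_of_nonneg_left ?_ (by positivity)
          exact hκV (u f) (τ f) (hu0 f) (huτ f) (sum_le_of_assignment hβ (huO f) (huτ f))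
      _ = (Fintype.card F : ℝ) * (2 * (B : ℝ) ^ 6 / P.m) := by
          rw [← nsmul_eq_mul, ← Finset.card_univ]
          refine Finset.sum_eq_card_nsmul fun f _ => ?_
          have := (hτ0 f).ne'
          simp only [hd]
          field_simp
      _ ≤ (B : ℝ) ^ 3 * (2 * (B : ℝ) ^ 6 / P.m) := by
          have : (Fintype.card F : ℝ) ≤ B ^ 3 := by exact_mod_cast hF
          gcongr
      _ = 2 * (B : ℝ) ^ 9 / P.m := by ring
      _ ≤ ε := by
          rw [div_le_iff₀ hm0, hqm]
          have h1 : (B : ℝ) ^ 10 ≤ q := by exact_mod_cast hBq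
          refine le_trans ?_ h1
          have h2 : (2 : ℝ) ≤ B := by exact_mod_cast (by omega : 2 ≤ B)
          calc 2 * (B : ℝ) ^ 9 ≤ (B : ℝ) * (B : ℝ) ^ 9 := by gcongr
            _ = (B : ℝ) ^ 10 := by ring
  have hopt : 0 ≤ P.opt := hO ▸ setValue_nonneg O
  refine le_trans ?_ (PMF.expect_mono _ hh)
  rw [PMF.expect_const_mul, PMF.expect_sub, PMF.expect_const_mul, hEv, mul_assoc _ (p - ε)]
  refine mul_le_mul_of_nonneg_left ?_ (mul_nonneg (by linarith) hc0)
  have := mul_le_mul_of_nonneg_left hEbad hopt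
  linarith

/-! ### Summing the gains of the iterations. -/

theorem one_sub_le_gain_factor {r s : ℝ} (hs : 1 ≤ s) (hrs : s ≤ r) :
    1 - 11 / s ≤ (1 - 1 / r) * (1 - 1 / r) * (1 - 1 / s ^ 2) * (r / (r + 8)) := by
  have hs0 : 0 < s := by linarith
  have hr0 : 0 < r := by linarith
  have hr : 1 / r ≤ 1 / s := one_div_le_one_div_of_le hs0 hrs
  have hs1 : 1 / s ≤ 1 := (div_le_one hs0).2 hs
  have hr1 : 0 ≤ 1 / r := by positivity
  have hss : 1 / s ^ 2 ≤ 1 / s := by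
    rw [sq, ← div_div]
    exact div_le_self (by positivity) hs
  have hss0 : 0 ≤ 1 / s ^ 2 := by positivity
  have h8 : 1 - 8 * (1 / r) ≤ r / (r + 8) := by
    rw [le_div_iff₀ (by linarith)]
    have : 8 * (1 / r) * r = 8 := by field_simp
    nlinarith
  have h81 : r / (r + 8) ≤ 1 := (div_le_one (by linarith)).2 (by linarith)
  set a := 1 / r
  set b := 1 / s ^ 2
  set c := r / (r + 8)
  set t := 1 / s
  -- The four factors lose at most `t`, `t`, `t` and `8 * t`, and the losses add up to `11 * t`.
  have h1 : 1 - 2 * t ≤ (1 - a) * (1 - a) := by nlinarith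
  have h2 : (1 - a) * (1 - a) ≤ 1 := mul_le_one₀ (by linarith) (by linarith) (by linarith)
  have h3 : 1 - 3 * t ≤ (1 - a) * (1 - a) * (1 - b) := by
    nlinarith [mul_nonneg (sub_nonneg.2 h2) hss0]
  have h4 : (1 - a) * (1 - a) * (1 - b) ≤ 1 := mul_le_one₀ h2 (by linarith) (by linarith)
  have h5 : 11 / s = 11 * t := by rw [mul_one_div]
  rw [h5]
  nlinarith [mul_nonneg (sub_nonneg.2 h4) (sub_nonneg.2 h81)]

/-- Iterative randomized rounding loses at most a fraction `12 / s` of the value of an optimal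
solution. -/
theorem le_expect_setValue_packed {s q B : ℕ} (hs : 2 ≤ s) (hq : 0 < q) (hm : P.m = q * s ^ 2)
    (hB : 8 * s ^ 8 ≤ B) (hBq : B ^ 10 ≤ q) (hBs : (2 * s ^ 2 + 1) ^ (2 * s ^ 4) ≤ B) {ε : ℝ}
    (hε : ε = 1 / s ^ 2) {X : P.LPRule q} (hX : X.IsApprox ε (s ^ 2)) :
    (1 - 12 / s) * P.opt ≤ (P.run X (s ^ 2)).expect fun h => P.setValue (P.packed h) := by
  have hs0 : 0 < s := by omega
  have hs' : (1 : ℝ) ≤ s := by exact_mod_cast hs0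
  have hopt : 0 ≤ P.opt := by
    obtain ⟨O, β, -, hO⟩ := P.exists_optimal_assignment
    exact hO ▸ setValue_nonneg O
  set V : ℕ → ℝ := fun j => (P.run X j).expect fun h => P.setValue (P.packed h) with hV
  have hstep : ∀ j, j + s ≤ s ^ 2 → V j + (1 - 11 / s) / s ^ 2 * P.opt ≤ V (j + 1) := by
    intro j hj
    -- `r` iterations remain, and the linear program has size `q * r`.
    set r : ℝ := s ^ 2 - j with hr
    have hrs : (s : ℝ) ≤ r := by
      have : (j : ℝ) + s ≤ s ^ 2 := by exact_mod_cast hj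
      linarith
    have hr0 : 0 < r := by linarith
    have hp : 1 - j * ε = r / s ^ 2 := by
      rw [hε, hr]
      field_simp
    have hl : (P.m : ℝ) * (1 - j * ε) = q * r := by
      rw [hp, hm]
      push_cast
      field_simp
    have hm0 : (0 : ℝ) < q := Nat.cast_pos.2 hq
    have h1 := expect_setValue_packed_succ (j := j) X (l := P.m * (1 - j * ε))
      (by rw [hl]; positivity) fun h => (hX j (by omega) h).1
    have h2 := le_expect_fracValue hs hq hm hB hBq hBs hε hX (j := j) (by omega) hp.symm
      (by positivity)
    have hqr : (q : ℝ) / (q * r) = 1 / r := by field_simp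
    rw [hl, hqr] at h1
    have h3 : 0 ≤ 1 / r * (1 - 1 / r) :=
      mul_nonneg (by positivity) (sub_nonneg.2 ((div_le_one hr0).2 (by linarith)))
    have h4 := mul_le_mul_of_nonneg_left h2 h3
    have h5 : 1 / r * (1 - 1 / r) * ((1 - ε) * (r / s ^ 2 / (r / s ^ 2 + 8 * ε))
        * (r / s ^ 2 - ε) * P.opt) = (1 - 1 / r) * (1 - 1 / r) * (1 - 1 / s ^ 2) * (r / (r + 8))
          / s ^ 2 * P.opt := by
      have e1 : r / (s : ℝ) ^ 2 / (r / s ^ 2 + 8 * ε) = r / (r + 8) := by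
        rw [hε]
        field_simp
      have e2 : r / (s : ℝ) ^ 2 - ε = r * (1 - 1 / r) / s ^ 2 := by
        rw [hε]
        field_simp
      rw [e1, e2, hε]
      field_simp
    rw [h5] at h4
    have h6 : (1 - 11 / s) / s ^ 2 * P.opt ≤ (1 - 1 / r) * (1 - 1 / r) * (1 - 1 / s ^ 2)
        * (r / (r + 8)) / s ^ 2 * P.opt := by
      have := one_sub_le_gain_factor hs' hrs
      gcongr
    linarith
  have hind : ∀ j, j + s ≤ s ^ 2 + 1 → j * ((1 - 11 / s) / s ^ 2 * P.opt) ≤ V j := by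
    intro j
    induction j with
    | zero =>
      intro _
      rw [Nat.cast_zero, zero_mul]
      exact PMF.expect_nonneg _ fun h => setValue_nonneg _
    | succ j ih =>
      intro hj
      have h1 := ih (by omega)
      have h2 := hstep j (by omega)
      push_cast
      linarith
  have hmono : Monotone V := monotone_nat_of_le_succ fun j => expect_setValue_packed_mono X
  have hss : s ≤ s ^ 2 := Nat.le_self_pow (by norm_num) s
  -- For the last `s` iterations only monotonicity is used; giving them up costs the twelfth `1 /
  -- s`.
  have h1 := (hind (s ^ 2 - s) (by omega)).trans (hmono (Nat.sub_le _ _))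
  refine le_trans ?_ h1
  rw [← mul_assoc]
  refine mul_le_mul_of_nonneg_right ?_ hopt
  rw [Nat.cast_sub hss]
  push_cast
  have e : ((s : ℝ) ^ 2 - s) * ((1 - 11 / s) / s ^ 2) = 1 - 12 / s + 11 / s ^ 2 := by
    field_simp
    ring
  rw [e]
  have : 0 ≤ 11 / (s : ℝ) ^ 2 := by positivity
  linarith

/-- A doubly exponential number exceeds the number of structures that have to be controlled. -/
theorem structure_bound {s : ℕ} (hs : 4 ≤ s) {m : ℕ}
    (hm : Real.exp (Real.exp ((s : ℝ) ^ 60)) < m) :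
    ((2 * s ^ 2 + 1) ^ (2 * s ^ 4)) ^ 11 ≤ m := by
  have hs4 : (4 : ℝ) ≤ s := by exact_mod_cast hs
  have h1 : (2 * (s : ℝ) ^ 2 + 1) ^ (2 * s ^ 4 * 11) ≤ Real.exp (44 * s ^ 6) := by
    calc (2 * (s : ℝ) ^ 2 + 1) ^ (2 * s ^ 4 * 11)
        ≤ Real.exp (2 * (s : ℝ) ^ 2) ^ (2 * s ^ 4 * 11) := by
          gcongr
          exact Real.add_one_le_exp _
      _ = Real.exp (44 * s ^ 6) := by
          rw [← Real.exp_nat_mul]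
          congr 1
          push_cast
          ring
  have h2 : 44 * (s : ℝ) ^ 6 ≤ (s : ℝ) ^ 60 := by
    calc 44 * (s : ℝ) ^ 6 ≤ (s : ℝ) ^ 54 * (s : ℝ) ^ 6 := by
          gcongr
          calc (44 : ℝ) ≤ 4 ^ 54 := by norm_num
            _ ≤ (s : ℝ) ^ 54 := by gcongr
      _ = (s : ℝ) ^ 60 := by ring
  have h3 : 44 * (s : ℝ) ^ 6 ≤ Real.exp ((s : ℝ) ^ 60) := by
    linarith [Real.add_one_le_exp ((s : ℝ) ^ 60)]
  have h4 : (2 * (s : ℝ) ^ 2 + 1) ^ (2 * s ^ 4 * 11) ≤ m :=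
    (h1.trans (Real.exp_le_exp.2 h3)).trans hm.le
  rw [← pow_mul]
  exact_mod_cast h4

end CMK

/-! ### Choice of the parameters. -/

theorem lemma3p7 {I : Type*} [Fintype I] [DecidableEq I] (ε : ℝ) (hε0 : 0 < ε) (hε1 : ε < 0.1)
    (hεs : ∃ s : ℕ, ε ^ (-(1 / 2) : ℝ) = s)
    (P : CMK I) (hP : P.IsSimple ε)
    (X : P.LPRule (P.batch ε)) (hX : X.IsApprox ε (CMK.numIter ε)) :
    (1 - 300 * ε ^ (1 / 2 : ℝ)) * P.opt ≤ P.expectedValue ε X := by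
  obtain ⟨s, hs⟩ := hεs
  obtain ⟨hm, q, hq⟩ := hP
  have hsqrt : ε ^ (1 / 2 : ℝ) = 1 / s := by
    rw [← hs, Real.rpow_neg hε0.le, one_div (_⁻¹), inv_inv]
  have hs0 : (0 : ℝ) < s := hs ▸ Real.rpow_pos_of_pos hε0 _
  have hε : ε = 1 / (s : ℝ) ^ 2 := by
    rw [← one_div_pow, ← hsqrt, ← Real.rpow_natCast, ← Real.rpow_mul hε0.le]
    norm_num
  have hs4 : 4 ≤ s := by
    by_contra hlt
    have h1 : (s : ℝ) ≤ 3 := by exact_mod_cast (by omega : s ≤ 3)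
    have h2 : (s : ℝ) ^ 2 ≤ 9 := by nlinarith
    rw [hε, div_lt_iff₀ (by positivity)] at hε1
    linarith
  have hbatch : (P.batch ε : ℝ) = ε * P.m := by rw [CMK.batch, hq, Nat.floor_natCast]
  have hiter : CMK.numIter ε = s ^ 2 := by
    rw [CMK.numIter, hε, one_div, inv_inv, ← Nat.cast_pow, Nat.floor_natCast]
  have hmq : P.m = P.batch ε * s ^ 2 := by
    have : (P.m : ℝ) = P.batch ε * (s : ℝ) ^ 2 := by
      rw [hbatch, hε]
      field_simp
    exact_mod_cast this
  have hexp : ε ^ (-30 : ℤ) = (s : ℝ) ^ 60 := by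
    rw [hε, one_div, zpow_neg, inv_zpow, inv_inv, zpow_ofNat, ← pow_mul]
  rw [hexp] at hm
  -- The number of conceivable bin classes: a count in `0, …, 2 * s ^ 2` for each of the `2 * s ^ 4`
  -- groups of large items.
  set B := (2 * s ^ 2 + 1) ^ (2 * s ^ 4) with hBdef
  have hB11 : B ^ 11 ≤ P.m := CMK.structure_bound hs4 hm
  have hB : 8 * s ^ 8 ≤ B := by
    calc 8 * s ^ 8 ≤ 16 * s ^ 8 := by omega
      _ = (2 * s ^ 2) ^ 4 := by ring
      _ ≤ (2 * s ^ 2 + 1) ^ 4 := Nat.pow_le_pow_left (Nat.le_succ _) 4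
      _ ≤ B := by
          refine Nat.pow_le_pow_right (Nat.succ_pos _) ?_
          have : 4 ^ 4 ≤ s ^ 4 := Nat.pow_le_pow_left hs4 4
          omega
  have hsB : s ^ 2 ≤ B := by
    have : s ^ 2 ≤ s ^ 8 := Nat.pow_le_pow_right (by omega) (by norm_num)
    omega
  have hBq : B ^ 10 ≤ P.batch ε := by
    have h1 : B ^ 10 * s ^ 2 ≤ P.batch ε * s ^ 2 := by
      rw [← hmq]
      refine le_trans ?_ hB11
      rw [pow_succ B 10]
      exact Nat.mul_le_mul_left _ hsB
    exact Nat.le_of_mul_le_mul_right h1 (by positivity)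
  have hq0 : 0 < P.batch ε := lt_of_lt_of_le (by positivity) hBq
  have hmain : (1 - 12 / s) * P.opt ≤ P.expectedValue ε X := by
    have h := CMK.le_expect_setValue_packed (by omega) hq0 hmq hB hBq le_rfl hε (hiter ▸ hX)
    rw [← hiter] at h
    exact h
  refine le_trans (mul_le_mul_of_nonneg_right ?_ ?_) hmain
  · rw [hsqrt, mul_one_div]
    gcongr
    norm_num
  · obtain ⟨O, β, -, hO⟩ := P.exists_optimal_assignment
    exact hO ▸ CMK.setValue_nonneg O
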